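/- Let $G=(V,E)$ be an infinite, connected, locally finite graph. In Bernoulli bond percolation with parameter $p\in[0,1]$, each edge of $G$ is open independently with probability $p$; $\mathbb P_p$ denotes the law, $G_p$ the random open subgraph, its connected components are called clusters, and $K_v$ is the cluster of the vertex $v$. Let $p_c=\inf\{p\in[0,1]: G_p \text{ has an infinite cluster almost surely}\}$. For $S\subseteq V$, $\{S\leftrightarrow\infty\}$ is the event that $S$ is connected to infinity by an open path (that is, some vertex of $S$ lies in an infinite cluster), $\{S\nleftrightarrow\infty\}$ is its complement and, for $v\notin S$, $\{v\leftrightarrow\infty\text{ off }S\}$ is the event that $v$ is connected to infinity by an open path that does not visit any vertex of $S$. Let $\partial_E^{\rightarrow}S$ be the set of oriented edges $e$ of $G$ with $e^-\in S$ and $e^+\notin S$. For $d>1$, a connected, locally finite graph $H$ satisfies an anchored $d$-dimensional isoperimetric inequality if for some (for infinite $H$, equivalently every) vertex $v$ there is $c>0$ with $|\partial_E W|\ge c\bigl(\sum_{w\in W}\deg(w)\bigr)^{(d-1)/d}$ for every finite connected set $W$ of vertices containing $v$, where $\partial_E W$ is the set of edges of $H$ with exactly one endpoint in $W$ and degrees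 are taken in $H$. The anchored isoperimetric dimension of $H$ is the supremum of the $d>1$ for which this holds. **Theorem.** Let $p_c\le p_0<1$ and $d\in(1,\infty]$. Consider the following conditions. (i) For all $p_0<p\le 1$ and all real $1<d'<d$ there is $c=c(p,d')>0$ such that $\mathbb P_p(S\nleftrightarrow\infty)\le\exp\bigl[-c|S|^{(d'-1)/d'}\bigr]$ for every finite non-empty $S\subseteq V$. (ii) For all $p_0<p\le 1$ and all real $1<d'<d$ there is $c=c(p,d')>0$ such that $\sum_{e\in\partial_E^{\rightarrow}S}\mathbb P_p(e^+\leftrightarrow\infty\text{ off }S)\ge c|S|^{(d'-1)/d'}$ for every finite non-empty $S\subseteq V$. (iii) For all $p_0<p\le 1$ and all real $1<d'<d$ there is $c=c(p,d')>0$ such that $\mathbb P_p(n\le|K_v|<\infty)\le\exp\bigl[-c\,n^{(d'-1)/d'}\bigr]$ for every $v\in V$ and $n\ge 1$. (iv) For all $p_0<p\le 1$, almost surely every infinite cluster of $G_p$ has anchored isoperimetric dimension at least $d$. If $G$ is transitive (its automorphisms act transitively on $V$), then (i), (ii), (iii) and (iv) are equivalent. If $G$ has bounded degree (and is not necessarily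 transitive), then (i) $\Leftrightarrow$ (ii), (ii) $\Rightarrow$ (iii) and (iii) $\Rightarrow$ (iv). -/

import Mathlib

open MeasureTheory ProbabilityTheory
open scoped unitInterval

namespace Percolation

noncomputable section

universe u

variable {V : Type u}

/-- `G` is (vertex-)transitive: any vertex is mapped to any other by an automorphism. -/
def IsTransitive (G : SimpleGraph V) : Prop :=
  ∀ a b : V, ∃ φ : G ≃g G, φ a = b

/-- `G` has bounded degree. -/
def IsBoundedDegree (G : SimpleGraph V) [G.LocallyFinite] : Prop :=
  ∃ D : ℕ, ∀ v : V, G.degree v ≤ D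

/-! ### Isoperimetry -/

/-- The edge boundary of `W` in `H`: edges with one endpoint in `W` and the other outside `W`. -/
def edgeBoundary (H : SimpleGraph V) (W : Set V) : Set (Sym2 V) :=
  {e | ∃ a ∈ W, ∃ b ∉ W, H.Adj a b ∧ e = s(a, b)}

/-- The degree of a vertex, as the number of its neighbours (for locally finite graphs). -/
def deg (H : SimpleGraph V) (v : V) : ℕ := (H.neighborSet v).ncard

/-- The anchored `d`-dimensional isoperimetric inequality for a locally finite graph `H`. On
connected infinite graphs it does not depend on the choice of the anchor `v`. -/
def AnchoredIsoperimetricInequality (H : SimpleGraph V) (d : ℝ) : Prop :=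
  ∃ v : V, ∃ c : ℝ, 0 < c ∧ ∀ W : Finset V, v ∈ W → (H.induce (W : Set V)).Connected →
    c * ((∑ w ∈ W, deg H w : ℕ) : ℝ) ^ ((d - 1) / d) ≤ ((edgeBoundary H (W : Set V)).ncard : ℝ)

/-- The anchored isoperimetric dimension: the supremum of all `d > 1` for which the anchored
`d`-dimensional isoperimetric inequality holds (it is `⊥` if there is no such `d`). -/
def anchoredIsoperimetricDimension (H : SimpleGraph V) : EReal :=
  sSup {x : EReal | ∃ d : ℝ, 1 < d ∧ AnchoredIsoperimetricInequality H d ∧ x = (d : EReal)}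

/-! ### Bernoulli bond percolation -/

/-- A percolation configuration on `G`: `true` marks the open (retained) edges. -/
abbrev Configuration (G : SimpleGraph V) : Type u := G.edgeSet → Bool

/-- The law of Bernoulli bond percolation with retention probability `p`: the edges are open
independently of each other, each with probability `p`. -/
def bondMeasure (G : SimpleGraph V) (p : I) : Measure (Configuration G) :=
  Measure.infinitePi fun _ : G.edgeSet ↦ bernoulliMeasure true false p

/-- The open subgraph of a configuration, on the full vertex set. Its connected components are the
clusters. -/
def openGraph (G : SimpleGraph V) (ω : Configuration G) : SimpleGraph V where
  Adj a b := ∃ h : G.Adj a b, ω ⟨s(a, b), h⟩ = true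
  symm := by
    constructor
    rintro a b ⟨h, hω⟩
    refine ⟨h.symm, ?_⟩
    rw [← hω]
    congr 2
    exact Sym2.eq_swap
  loopless := ⟨fun a ⟨h, _⟩ ↦ G.loopless.irrefl a h⟩

/-- The cluster of the vertex `v`. -/
def cluster (G : SimpleGraph V) (ω : Configuration G) (v : V) : Set V :=
  {x | (openGraph G ω).Reachable v x}

/-- The event that some vertex of `S` is connected to infinity by an open path, i.e. lies in an
infinite cluster. -/
def connectedToInfinity (G : SimpleGraph V) (S : Set V) : Set (Configuration G) :=
  {ω | ∃ v ∈ S, (cluster G ω v).Infinite}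

/-- The event that `v` is connected to infinity off `S`: infinitely many vertices can be reached
from `v` by open paths that do not visit any vertex of `S`. -/
def connectedToInfinityOff (G : SimpleGraph V) (S : Set V) (v : V) : Set (Configuration G) :=
  {ω | {x | ∃ w : (openGraph G ω).Walk v x, ∀ y ∈ w.support, y ∉ S}.Infinite}

/-- The critical probability: the infimum of all `p ∈ [0, 1]` for which there is an infinite
cluster almost surely. -/
def criticalProbability (G : SimpleGraph V) : ℝ :=
  sInf {x : ℝ | ∃ p : I, (p : ℝ) = x ∧ ∀ᵐ ω ∂(bondMeasure G p), ∃ v : V, (cluster G ω v).Infinite}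

/-! ### The four conditions -/

/-- Condition (i): `P_p(S ↮ ∞) ≤ exp(-c |S|^((d'-1)/d'))`. -/
def DisconnectionBound (G : SimpleGraph V) (p₀ : ℝ) (d : EReal) : Prop :=
  ∀ p : I, p₀ < p → ∀ d' : ℝ, 1 < d' → (d' : EReal) < d →
    ∃ c : ℝ, 0 < c ∧ ∀ S : Finset V, S.Nonempty →
      (bondMeasure G p).real (connectedToInfinity G (S : Set V))ᶜ ≤
        Real.exp (-(c * (S.card : ℝ) ^ ((d' - 1) / d')))

open Classical in
/-- Condition (ii): the sum, over the oriented edges `(a, b)` of `G` with `a ∈ S` and `b ∉ S`, of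
the probabilities that `b` is connected to infinity off `S` is at least `c |S|^((d'-1)/d')`. -/
def BoundaryBound (G : SimpleGraph V) [G.LocallyFinite] (p₀ : ℝ) (d : EReal) : Prop :=
  ∀ p : I, p₀ < p → ∀ d' : ℝ, 1 < d' → (d' : EReal) < d →
    ∃ c : ℝ, 0 < c ∧ ∀ S : Finset V, S.Nonempty →
      c * (S.card : ℝ) ^ ((d' - 1) / d') ≤
        ∑ a ∈ S, ∑ b ∈ G.neighborFinset a \ S,
          (bondMeasure G p).real (connectedToInfinityOff G (S : Set V) b)

/-- Condition (iii): `P_p(n ≤ |K_v| < ∞) ≤ exp(-c n^((d'-1)/d'))`, with `c` not depending on the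
vertex `v`. -/
def VolumeTailBound (G : SimpleGraph V) (p₀ : ℝ) (d : EReal) : Prop :=
  ∀ p : I, p₀ < p → ∀ d' : ℝ, 1 < d' → (d' : EReal) < d →
    ∃ c : ℝ, 0 < c ∧ ∀ v : V, ∀ n : ℕ, 1 ≤ n →
      (bondMeasure G p).real {ω | (cluster G ω v).Finite ∧ n ≤ (cluster G ω v).ncard} ≤
        Real.exp (-(c * (n : ℝ) ^ ((d' - 1) / d')))

/-- Condition (iv): almost surely, every infinite cluster, as a graph with its open edges, has
anchored isoperimetric dimension at least `d`. -/
def ClusterDimensionBound (G : SimpleGraph V) (p₀ : ℝ) (d : EReal) : Prop :=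
  ∀ p : I, p₀ < p → ∀ᵐ ω ∂(bondMeasure G p),
    ∀ C : (openGraph G ω).ConnectedComponent, C.supp.Infinite →
      d ≤ anchoredIsoperimetricDimension C.toSimpleGraph

end

end Percolation

namespace Percolation

universe u

variable {V : Type u} {G : SimpleGraph V}

/-! ### Measures on configurations -/

/-! Let α = (d'-1)/d', and let `escapes` count the boundary darts of a finite set whose outer
endpoint is connected to infinity off the set. This count depends only on edges that do not touch
the set, so it is independent of the states of the boundary edges themselves.

(i) ⇒ (ii): closing every escaping boundary edge disconnects `S`, so P(S ↮ ∞) ≥ E[(1-q)^escapes] ≥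
(1-q)^(E escapes) by Jensen. Hence a small disconnection probability forces a large mean
(`pow_meanEscapes_le`).

(ii) ⇒ (i): run percolation in the time t = -log(1-p). If the finite cluster of `S` is `T ⊇ S`, only
edges touching `T` have been explored, so the mean number of escapes of `T` is unaffected and is at
least B = c|S|^α. A sprinkle of duration s then opens an escape with probability of order sB
(`sum_real_clusterOf_mul_le`). The disconnection probability therefore decays at rate at least B/2
in t (`real_compl_connectedToInfinity_le`).

(i) ⇒ (iii): obtain p-percolation by sprinkling onto q-percolation, q < p, and let `T` be the finite
p-cluster of `v`. Either `T` has few q-escapes, which (i) and an exponential Markov bound make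
unlikely (`real_escapes_le`), or it has many and sprinkling opened none of them, which is
exponentially unlikely by cluster repulsion (`real_cluster_repulsion`).

(iii) ⇒ (iv), bounded degree: a connected `W` containing `v` with at most t open boundary edges
becomes the cluster of `v` once these are closed. The price is a factor (C|W|)^t
(`real_connected_inter_le`), which the volume tail absorbs when t = |W|^β with β < α. Summing over
sizes gives anchored isoperimetry (`VolumeTailBound.exists_anchoredAt`).

(iv) ⇒ (ii), transitive: some vertex satisfies an anchored inequality with a fixed constant with
positive probability, and by invariance every vertex does. A double count shows that a set with many
such vertices has many escapes (`card_mul_le_escapes`), and taking expectations gives (ii). The same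
count gives (iii) ⇒ (ii) in bounded degree, which handles p = 1 in (iii) ⇒ (iv), where no edge can
be closed. -/

instance instIsProbabilityMeasureBondMeasure (p : I) : IsProbabilityMeasure (bondMeasure G p) := by
  unfold bondMeasure; infer_instance

theorem real_prod_apply {α β : Type*} [MeasurableSpace α] [MeasurableSpace β]
    {μ : Measure α} {ν : Measure β} [IsProbabilityMeasure μ] [IsProbabilityMeasure ν]
    {s : Set (α × β)} (hs : MeasurableSet s) :
    (μ.prod ν).real s = ∫ x, ν.real (Prod.mk x ⁻¹' s) ∂μ := by
  simp only [measureReal_def]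
  rw [Measure.prod_apply hs, integral_toReal]
  · exact (measurable_measure_prodMk_left hs).aemeasurable
  · exact Filter.Eventually.of_forall fun x ↦ measure_lt_top _ _

theorem real_prod_apply_symm {α β : Type*} [MeasurableSpace α] [MeasurableSpace β]
    {μ : Measure α} {ν : Measure β} [IsProbabilityMeasure μ] [IsProbabilityMeasure ν]
    {s : Set (α × β)} (hs : MeasurableSet s) :
    (μ.prod ν).real s = ∫ y, μ.real ((fun x ↦ (x, y)) ⁻¹' s) ∂ν := by
  simp only [measureReal_def]
  rw [Measure.prod_apply_symm hs, integral_toReal]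
  · exact (measurable_measure_prodMk_right hs).aemeasurable
  · exact Filter.Eventually.of_forall fun x ↦ measure_lt_top _ _

theorem measurable_real_prodMk_left {α β : Type*} [MeasurableSpace α] [MeasurableSpace β]
    {ν : Measure β} [IsProbabilityMeasure ν] {s : Set (α × β)} (hs : MeasurableSet s) :
    Measurable fun x ↦ ν.real (Prod.mk x ⁻¹' s) :=
  (measurable_measure_prodMk_left hs).ennreal_toReal

/-- A bounded measurable real function is integrable. -/
theorem integrable_of_measurable_of_bounded {α : Type*} [MeasurableSpace α] {μ : Measure α}
    [IsFiniteMeasure μ] {f : α → ℝ} (hf : Measurable f) (C : ℝ) (hC : ∀ x, |f x| ≤ C) :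
    Integrable f μ :=
  Integrable.of_bound hf.aestronglyMeasurable C (Filter.Eventually.of_forall hC)

/-- The probability that all edges of a finite set are closed. -/
theorem bondMeasure_real_closed (p : I) (F : Finset G.edgeSet) :
    (bondMeasure G p).real {ω | ∀ e ∈ F, ω e = false} = (1 - (p : ℝ)) ^ F.card := by
  have h : {ω : Configuration G | ∀ e ∈ F, ω e = false} =
      (F : Set G.edgeSet).pi fun _ ↦ ({false} : Set Bool) := by
    ext ω; simp
  rw [h, measureReal_def, bondMeasure, Measure.infinitePi_pi]
  · rw [ENNReal.toReal_prod, Finset.prod_congr rfl (g := fun _ ↦ 1 - (p : ℝ)), Finset.prod_const]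
    intro e _
    rw [← measureReal_def,
      bernoulliMeasure_real_apply_of_notMem_of_mem p (measurableSet_singleton _) (by simp)
        (by simp)]
  · intro i _
    exact measurableSet_singleton _

theorem measurableSet_closed (F : Finset G.edgeSet) :
    MeasurableSet {ω : Configuration G | ∀ e ∈ F, ω e = false} := by
  have h : {ω : Configuration G | ∀ e ∈ F, ω e = false} =
      ⋂ e ∈ F, (fun ω : Configuration G ↦ ω e) ⁻¹' {false} := by
    ext ω; simp
  rw [h]
  exact F.measurableSet_biInter fun e _ ↦ measurable_pi_apply e (measurableSet_singleton _)

/-- These events are stable under intersection (take the union of the edge sets), so they form a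
generating π-system. Every identity of laws below is reduced to powers of 1 - p on them. -/
theorem generateFrom_closed :
    (MeasurableSpace.pi : MeasurableSpace (Configuration G)) =
      MeasurableSpace.generateFrom
        (Set.range fun F : Finset G.edgeSet ↦ {ω : Configuration G | ∀ e ∈ F, ω e = false}) := by
  apply le_antisymm
  · refine iSup_le fun e ↦ ?_
    rw [← measurable_iff_comap_le]
    refine @measurable_to_bool _ (MeasurableSpace.generateFrom _) _ ?_
    have : (fun ω : Configuration G ↦ ω e) ⁻¹' {true} =
        {ω : Configuration G | ∀ e' ∈ ({e} : Finset G.edgeSet), ω e' = false}ᶜ := by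
      ext ω; simp
    rw [this]
    exact MeasurableSet.compl (MeasurableSpace.measurableSet_generateFrom (Set.mem_range_self {e}))
  · refine MeasurableSpace.generateFrom_le ?_
    rintro _ ⟨F, rfl⟩
    exact measurableSet_closed F

/-- Two probability measures on configurations agree if all finite sets of edges are closed with
the same probabilities. -/
theorem measure_ext_of_closed {μ ν : Measure (Configuration G)} [IsProbabilityMeasure μ]
    [IsProbabilityMeasure ν]
    (h : ∀ F : Finset G.edgeSet, μ.real {ω | ∀ e ∈ F, ω e = false} =
      ν.real {ω | ∀ e ∈ F, ω e = false}) : μ = ν := by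
  classical
  refine ext_of_generate_finite _ generateFrom_closed ?_ ?_ (by simp)
  · rintro _ ⟨F, rfl⟩ _ ⟨F', rfl⟩ _
    refine ⟨F ∪ F', ?_⟩
    ext ω
    simp only [Finset.mem_union, Set.mem_ofPred_eq, Set.mem_inter_iff]
    grind
  · rintro _ ⟨F, rfl⟩
    exact (measureReal_eq_measureReal_iff).1 (h F)

/-- The superposition of two configurations. -/
def superpose (x : Configuration G × Configuration G) : Configuration G := fun e ↦ x.1 e || x.2 e

theorem measurable_superpose : Measurable (superpose (G := G)) := by
  refine measurable_pi_lambda _ fun e ↦ ?_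
  have h : Measurable fun b : Bool × Bool ↦ b.1 || b.2 := measurable_of_finite _
  have h2 : Measurable fun x : Configuration G × Configuration G ↦ (x.1 e, x.2 e) := by fun_prop
  exact h.comp h2

/-- Sprinkling: superposing independent percolations yields a percolation. -/
theorem map_superpose {p q r : I} (h : 1 - (r : ℝ) = (1 - p) * (1 - q)) :
    ((bondMeasure G p).prod (bondMeasure G q)).map superpose = bondMeasure G r := by
  have : IsProbabilityMeasure (((bondMeasure G p).prod (bondMeasure G q)).map superpose) :=
    Measure.isProbabilityMeasure_map measurable_superpose.aemeasurable
  refine measure_ext_of_closed fun F ↦ ?_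
  rw [map_measureReal_apply measurable_superpose (measurableSet_closed F)]
  have h' : superpose ⁻¹' {ω : Configuration G | ∀ e ∈ F, ω e = false} =
      {ω : Configuration G | ∀ e ∈ F, ω e = false} ×ˢ
        {ω : Configuration G | ∀ e ∈ F, ω e = false} := by
    ext ⟨ω, η⟩
    simp only [superpose, Set.mem_preimage, Set.mem_ofPred_eq, Bool.or_eq_false_iff, Set.mem_prod]
    grind
  rw [h', measureReal_prod_prod]
  simp only [bondMeasure_real_closed]
  rw [h, mul_pow]

open Classical in
/-- The configuration that agrees with the first argument on `A` and with the second off `A`. -/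
noncomputable def splice (A : Set G.edgeSet) (x : Configuration G × Configuration G) :
    Configuration G :=
  fun e ↦ if e ∈ A then x.1 e else x.2 e

theorem splice_of_mem {A : Set G.edgeSet} {e : G.edgeSet} (he : e ∈ A)
    (x : Configuration G × Configuration G) : splice A x e = x.1 e := if_pos he

theorem splice_of_notMem {A : Set G.edgeSet} {e : G.edgeSet} (he : e ∉ A)
    (x : Configuration G × Configuration G) : splice A x e = x.2 e := if_neg he

theorem measurable_splice (A : Set G.edgeSet) : Measurable (splice A) := by
  refine measurable_pi_lambda _ fun e ↦ ?_
  by_cases he : e ∈ A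
  · simp only [splice_of_mem he]; fun_prop
  · simp only [splice_of_notMem he]; fun_prop

/-- Resampling the edges off `A` does not change the law. This is the source of all independence
statements: one event is read from the first copy, the other from the second. -/
theorem map_splice (A : Set G.edgeSet) (p : I) :
    ((bondMeasure G p).prod (bondMeasure G p)).map (splice A) = bondMeasure G p := by
  classical
  have : IsProbabilityMeasure (((bondMeasure G p).prod (bondMeasure G p)).map (splice A)) :=
    Measure.isProbabilityMeasure_map (measurable_splice A).aemeasurable
  refine measure_ext_of_closed fun F ↦ ?_
  rw [map_measureReal_apply (measurable_splice A) (measurableSet_closed F)]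
  have h' : splice A ⁻¹' {ω : Configuration G | ∀ e ∈ F, ω e = false} =
      {ω : Configuration G | ∀ e ∈ F.filter (· ∈ A), ω e = false} ×ˢ
        {ω : Configuration G | ∀ e ∈ F.filter (· ∉ A), ω e = false} := by
    ext ⟨ω, η⟩
    simp only [Set.mem_preimage, Set.mem_ofPred_eq, Set.mem_prod, Finset.mem_filter, splice]
    grind
  rw [h', measureReal_prod_prod]
  simp only [bondMeasure_real_closed]
  rw [← pow_add, Finset.card_filter_add_card_filter_not]

/-- Membership of a configuration in `X` is determined by the states of the edges in `A`. -/
def DeterminedBy (X : Set (Configuration G)) (A : Set G.edgeSet) : Prop :=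
  ∀ ⦃ω ω' : Configuration G⦄, (∀ e ∈ A, ω e = ω' e) → ω ∈ X → ω' ∈ X

theorem DeterminedBy.iff {X : Set (Configuration G)} {A : Set G.edgeSet} (h : DeterminedBy X A)
    {ω ω' : Configuration G} (hω : ∀ e ∈ A, ω e = ω' e) : ω ∈ X ↔ ω' ∈ X :=
  ⟨h hω, h fun e he ↦ (hω e he).symm⟩

theorem DeterminedBy.mono {X : Set (Configuration G)} {A B : Set G.edgeSet}
    (h : DeterminedBy X A) (hAB : A ⊆ B) : DeterminedBy X B :=
  fun _ _ hω ↦ h fun e he ↦ hω e (hAB he)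

/-- An event determined by finitely many edges is measurable. -/
theorem DeterminedBy.measurableSet {X : Set (Configuration G)} {A : Set G.edgeSet}
    (h : DeterminedBy X A) (hA : A.Finite) : MeasurableSet X := by
  have := hA.to_subtype
  -- `X` is the preimage of its image under restriction to `A`, and that image lies in a finite
  -- discrete space.
  have hX : X = A.domRestrict ⁻¹' (A.domRestrict '' X) := by
    apply le_antisymm (Set.subset_preimage_image _ _)
    rintro ω ⟨ω', hω', he⟩
    exact h (fun e he' ↦ congrFun he ⟨e, he'⟩) hω'
  rw [hX]
  exact (measurable_pi_lambda _ fun e ↦ measurable_pi_apply _) (Set.toFinite _).measurableSet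

/-- Events determined by disjoint sets of edges are independent. -/
theorem DeterminedBy.real_inter {X Y : Set (Configuration G)} {A : Set G.edgeSet}
    (hX : DeterminedBy X A) (hY : DeterminedBy Y Aᶜ) (mX : MeasurableSet X)
    (mY : MeasurableSet Y) (p : I) :
    (bondMeasure G p).real (X ∩ Y) = (bondMeasure G p).real X * (bondMeasure G p).real Y := by
  rw [← measureReal_prod_prod, ← map_splice A p,
    map_measureReal_apply (measurable_splice A) (mX.inter mY), map_splice A p]
  congr 1
  ext x
  have h1 : splice A x ∈ X ↔ x.1 ∈ X := hX.iff fun e he ↦ splice_of_mem he x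
  have h2 : splice A x ∈ Y ↔ x.2 ∈ Y := hY.iff fun e he ↦ splice_of_notMem he x
  simp [h1, h2]

/-- Independence in the presence of an additional independent source of randomness. -/
theorem real_prod_inter_fst {β : Type*} [MeasurableSpace β] {ν : Measure β}
    [IsProbabilityMeasure ν] {X : Set (Configuration G × β)} {Y : Set (Configuration G)}
    {A : Set G.edgeSet} (hX : ∀ y, DeterminedBy ((fun x ↦ (x, y)) ⁻¹' X) A)
    (hY : DeterminedBy Y Aᶜ) (mX : MeasurableSet X) (mY : MeasurableSet Y) (p : I) :
    ((bondMeasure G p).prod ν).real (X ∩ Prod.fst ⁻¹' Y) =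
      ((bondMeasure G p).prod ν).real X * (bondMeasure G p).real Y := by
  rw [real_prod_apply_symm (mX.inter (measurable_fst mY)), real_prod_apply_symm mX,
    ← integral_mul_const]
  refine integral_congr_ae (Filter.Eventually.of_forall fun y ↦ ?_)
  exact (hX y).real_inter hY (measurable_prodMk_right mX) mY p

/-! ### Closing the edges that correspond to occurring events -/

section Closing

variable {ι α : Type*}

open Classical in
/-- The number of the events `X i`, `i ∈ s`, that occur at `x`. -/
noncomputable def occurring (s : Finset ι) (X : ι → Set α) (x : α) : ℕ := (s.filter (x ∈ X ·)).card

open Classical in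
theorem occurring_le_card (s : Finset ι) (X : ι → Set α) (x : α) : occurring s X x ≤ s.card :=
  Finset.card_filter_le _ _

theorem occurring_eq_sum (s : Finset ι) (X : ι → Set α) (x : α) :
    (occurring s X x : ℝ) = ∑ i ∈ s, (X i).indicator (1 : α → ℝ) x := by
  classical
  simp only [occurring, Finset.card_filter, Nat.cast_sum, Set.indicator_apply, Pi.one_apply]
  push_cast
  rfl

variable [MeasurableSpace α]

theorem measurable_occurring_real (s : Finset ι) {X : ι → Set α}
    (hX : ∀ i, MeasurableSet (X i)) : Measurable fun x ↦ (occurring s X x : ℝ) := by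
  simp only [occurring_eq_sum]
  exact Finset.measurable_fun_sum _ fun i _ ↦ measurable_one.indicator (hX i)

theorem measurable_occurring (s : Finset ι) {X : ι → Set α}
    (hX : ∀ i, MeasurableSet (X i)) : Measurable fun x ↦ occurring s X x := by
  classical
  simp only [occurring, Finset.card_filter]
  exact Finset.measurable_fun_sum _ fun i _ ↦
    Measurable.ite (hX i) measurable_const measurable_const

theorem integrable_occurring (μ : Measure α) [IsFiniteMeasure μ] (s : Finset ι) {X : ι → Set α}
    (hX : ∀ i, MeasurableSet (X i)) : Integrable (fun x ↦ (occurring s X x : ℝ)) μ :=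
  integrable_of_measurable_of_bounded (measurable_occurring_real s hX) s.card fun x ↦ by
    rw [abs_of_nonneg (by positivity)]
    exact_mod_cast occurring_le_card s X x

theorem integral_occurring (μ : Measure α) [IsFiniteMeasure μ] (s : Finset ι) {X : ι → Set α}
    (hX : ∀ i, MeasurableSet (X i)) : ∫ x, (occurring s X x : ℝ) ∂μ = ∑ i ∈ s, μ.real (X i) := by
  simp only [occurring_eq_sum]
  rw [integral_finsetSum]
  · simp [integral_indicator_one (hX _)]
  · exact fun i _ ↦ (integrable_const (1 : ℝ)).indicator (hX i)

theorem measurableSet_closing (s : Finset ι) {X : ι → Set α} (hX : ∀ i, MeasurableSet (X i))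
    (e : ι → G.edgeSet) :
    MeasurableSet {x : α × Configuration G | ∀ i ∈ s, x.1 ∈ X i → x.2 (e i) = false} := by
  have h : {x : α × Configuration G | ∀ i ∈ s, x.1 ∈ X i → x.2 (e i) = false} =
      ⋂ i ∈ s, ((Prod.fst ⁻¹' X i)ᶜ ∪ (fun x : α × Configuration G ↦ x.2 (e i)) ⁻¹' {false}) := by
    ext x
    simp [imp_iff_not_or]
  rw [h]
  refine s.measurableSet_biInter fun i _ ↦ (measurable_fst (hX i)).compl.union ?_
  have hm : Measurable fun x : α × Configuration G ↦ x.2 (e i) := by fun_prop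
  exact hm (measurableSet_singleton _)

/-- The probability that all edges that correspond to occurring events are closed in an independent
percolation. -/
theorem real_prod_closing (μ : Measure α) [IsProbabilityMeasure μ] (s : Finset ι)
    {X : ι → Set α} (hX : ∀ i, MeasurableSet (X i)) {e : ι → G.edgeSet}
    (he : Set.InjOn e s) (p : I) :
    (μ.prod (bondMeasure G p)).real {x | ∀ i ∈ s, x.1 ∈ X i → x.2 (e i) = false} =
      ∫ x, (1 - (p : ℝ)) ^ occurring s X x ∂μ := by
  classical
  rw [real_prod_apply (measurableSet_closing s hX e)]
  refine integral_congr_ae (Filter.Eventually.of_forall fun x ↦ ?_)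
  have h : Prod.mk x ⁻¹' {x : α × Configuration G | ∀ i ∈ s, x.1 ∈ X i → x.2 (e i) = false} =
      {ω | ∀ f ∈ (s.filter (x ∈ X ·)).image e, ω f = false} := by
    ext ω
    simp only [Set.mem_preimage, Set.mem_ofPred_eq, Finset.forall_mem_image, Finset.mem_filter,
      and_imp]
  simp only [h, bondMeasure_real_closed]
  rw [Finset.card_image_of_injOn (he.mono (by simp +contextual [Set.subset_def])), occurring]

theorem integrable_pow_occurring (μ : Measure α) [IsFiniteMeasure μ] (s : Finset ι)
    {X : ι → Set α} (hX : ∀ i, MeasurableSet (X i)) {a : ℝ} (h0 : 0 ≤ a) (h1 : a ≤ 1) :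
    Integrable (fun x ↦ a ^ occurring s X x) μ :=
  integrable_of_measurable_of_bounded
    ((measurable_of_countable fun n : ℕ ↦ a ^ n).comp (measurable_occurring s hX)) 1 fun x ↦ by
      rw [abs_of_nonneg (by positivity)]
      exact pow_le_one₀ h0 h1

end Closing

/-! ### Clusters -/

theorem openGraph_adj {ω : Configuration G} {a b : V} :
    (openGraph G ω).Adj a b ↔ ∃ h : G.Adj a b, ω ⟨s(a, b), h⟩ = true := Iff.rfl

theorem openGraph_le (ω : Configuration G) : openGraph G ω ≤ G := fun _ _ h ↦ h.1

theorem openGraph_mono {ω ω' : Configuration G} (h : ∀ e, ω e = true → ω' e = true) :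
    openGraph G ω ≤ openGraph G ω' := fun _ _ hab ↦ ⟨hab.1, h _ hab.2⟩

/-- A set that is closed under adjacency contains everything that is reachable from it. -/
theorem mem_of_reachable {H : SimpleGraph V} {T : Set V} (hT : ∀ x ∈ T, ∀ y, H.Adj x y → y ∈ T)
    {a b : V} (ha : a ∈ T) (h : H.Reachable a b) : b ∈ T := by
  rw [SimpleGraph.reachable_iff_reflTransGen] at h
  induction h with
  | refl => exact ha
  | tail _ hbc ih => exact hT _ ih _ hbc

/-- The union of the clusters of the vertices of `S`. -/
def clusterOf (G : SimpleGraph V) (ω : Configuration G) (S : Set V) : Set V :=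
  {x | ∃ v ∈ S, (openGraph G ω).Reachable v x}

theorem clusterOf_eq_biUnion (ω : Configuration G) (S : Set V) :
    clusterOf G ω S = ⋃ v ∈ S, cluster G ω v := by
  ext x; simp [clusterOf, cluster]

theorem clusterOf_singleton (ω : Configuration G) (v : V) :
    clusterOf G ω {v} = cluster G ω v := by
  simp [clusterOf_eq_biUnion]

theorem subset_clusterOf (ω : Configuration G) (S : Set V) : S ⊆ clusterOf G ω S :=
  fun v hv ↦ ⟨v, hv, SimpleGraph.Reachable.refl v⟩

theorem mem_cluster_self (ω : Configuration G) (v : V) : v ∈ cluster G ω v :=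
  SimpleGraph.Reachable.refl v

theorem clusterOf_mono {ω ω' : Configuration G} (h : ∀ e, ω e = true → ω' e = true) (S : Set V) :
    clusterOf G ω S ⊆ clusterOf G ω' S :=
  fun _ ⟨v, hv, hx⟩ ↦ ⟨v, hv, hx.mono (openGraph_mono h)⟩

theorem cluster_mono {ω ω' : Configuration G} (h : ∀ e, ω e = true → ω' e = true) (v : V) :
    cluster G ω v ⊆ cluster G ω' v :=
  fun _ hx ↦ SimpleGraph.Reachable.mono (openGraph_mono h) hx

theorem mem_clusterOf_of_adj {ω : Configuration G} {S : Set V} {x y : V}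
    (hx : x ∈ clusterOf G ω S) (h : (openGraph G ω).Adj x y) : y ∈ clusterOf G ω S :=
  ⟨hx.choose, hx.choose_spec.1, hx.choose_spec.2.trans h.reachable⟩

theorem mem_cluster_of_adj {ω : Configuration G} {v x y : V}
    (hx : x ∈ cluster G ω v) (h : (openGraph G ω).Adj x y) : y ∈ cluster G ω v :=
  SimpleGraph.Reachable.trans hx h.reachable

theorem cluster_eq_of_mem {ω : Configuration G} {v x : V} (h : x ∈ cluster G ω v) :
    cluster G ω x = cluster G ω v := by
  ext y
  exact ⟨fun hy ↦ SimpleGraph.Reachable.trans h hy,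
    fun hy ↦ SimpleGraph.Reachable.trans (SimpleGraph.Reachable.symm h) hy⟩

theorem notMem_connectedToInfinity_iff {ω : Configuration G} {S : Set V} (hS : S.Finite) :
    ω ∉ connectedToInfinity G S ↔ (clusterOf G ω S).Finite := by
  rw [clusterOf_eq_biUnion]
  simp only [connectedToInfinity, Set.mem_ofPred_eq, not_exists, not_and, Set.not_infinite]
  exact ⟨fun h ↦ hS.biUnion h, fun h v hv ↦ h.subset (Set.subset_biUnion_of_mem hv)⟩

/-! ### Closing the edges that touch a set -/

/-- The edges with at least one endpoint in `T`. -/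
def touching (G : SimpleGraph V) (T : Set V) : Set G.edgeSet := {e | ∃ x ∈ e.1, x ∈ T}

theorem mem_touching_left {T : Set V} {a b : V} (h : G.Adj a b) (ha : a ∈ T) :
    (⟨s(a, b), h⟩ : G.edgeSet) ∈ touching G T := ⟨a, Sym2.mem_mk_left a b, ha⟩

theorem mem_touching_right {T : Set V} {a b : V} (h : G.Adj a b) (hb : b ∈ T) :
    (⟨s(a, b), h⟩ : G.edgeSet) ∈ touching G T := ⟨b, Sym2.mem_mk_right a b, hb⟩

open Classical in
/-- The configuration in which additionally all edges that touch `S` are closed. -/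
noncomputable def off (S : Set V) (ω : Configuration G) : Configuration G :=
  fun e ↦ if e ∈ touching G S then false else ω e

theorem off_le (S : Set V) (ω : Configuration G) (e : G.edgeSet) (h : off S ω e = true) :
    ω e = true := by
  unfold off at h; split_ifs at h; exact h

theorem openGraph_off_adj {S : Set V} {ω : Configuration G} {a b : V} :
    (openGraph G (off S ω)).Adj a b ↔ (openGraph G ω).Adj a b ∧ a ∉ S ∧ b ∉ S := by
  simp only [openGraph_adj, off]
  constructor
  · rintro ⟨h, hω⟩
    split_ifs at hω with he
    exact ⟨⟨h, hω⟩, fun ha ↦ he (mem_touching_left h ha), fun hb ↦ he (mem_touching_right h hb)⟩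
  · rintro ⟨⟨h, hω⟩, ha, hb⟩
    refine ⟨h, ?_⟩
    rw [if_neg]
    · exact hω
    · rintro ⟨x, hx, hxS⟩
      rcases Sym2.mem_iff.1 hx with rfl | rfl
      · exact ha hxS
      · exact hb hxS

theorem measurable_off (S : Set V) : Measurable (off (G := G) S) := by
  refine measurable_pi_lambda _ fun e ↦ ?_
  by_cases he : e ∈ touching G S
  · simp only [off, if_pos he]; fun_prop
  · simp only [off, if_neg he]; fun_prop

theorem off_congr {S : Set V} {ω ω' : Configuration G}
    (h : ∀ e ∈ (touching G S)ᶜ, ω e = ω' e) : off S ω = off S ω' := by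
  ext e
  by_cases he : e ∈ touching G S
  · simp [off, he]
  · simp [off, he, h e he]

theorem off_mono (S : Set V) {ω ω' : Configuration G} (h : ∀ e, ω e = true → ω' e = true)
    (e : G.edgeSet) (he : off S ω e = true) : off S ω' e = true := by
  unfold off at he ⊢
  split_ifs with h'
  · simp [h'] at he
  · simp only [if_neg h'] at he; exact h e he

theorem notMem_of_mem_cluster_off {S : Set V} {ω : Configuration G} {v x : V} (hv : v ∉ S)
    (hx : x ∈ cluster G (off S ω) v) : x ∉ S :=
  mem_of_reachable (T := Sᶜ) (fun _ _ _ h ↦ (openGraph_off_adj.1 h).2.2) hv hx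

theorem cluster_off_of_mem {S : Set V} {ω : Configuration G} {v : V} (hv : v ∈ S) :
    cluster G (off S ω) v = {v} := by
  apply Set.Subset.antisymm
  · intro x hx
    refine mem_of_reachable (T := {v}) ?_ rfl hx
    rintro _ rfl y hy
    exact absurd hv (openGraph_off_adj.1 hy).2.1
  · rintro _ rfl
    exact mem_cluster_self _ _

/-- Open paths avoiding `S` are paths after closing all edges that touch `S`, so locality,
monotonicity and measurability are inherited from ordinary clusters. For a start in `S` both sides
fail, since the modified cluster is a singleton. -/
theorem mem_connectedToInfinityOff {S : Set V} {ω : Configuration G} {v : V} :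
    ω ∈ connectedToInfinityOff G S v ↔ (cluster G (off S ω) v).Infinite := by
  by_cases hv : v ∈ S
  · rw [cluster_off_of_mem hv]
    have : {x | ∃ w : (openGraph G ω).Walk v x, ∀ y ∈ w.support, y ∉ S} = ∅ := by
      ext x
      simp only [Set.mem_ofPred_eq, Set.mem_empty_iff_false, iff_false, not_exists, not_forall]
      exact fun w ↦ ⟨v, w.start_mem_support, fun h ↦ h hv⟩
    simp [connectedToInfinityOff, this]
  · have : {x | ∃ w : (openGraph G ω).Walk v x, ∀ y ∈ w.support, y ∉ S} =
        cluster G (off S ω) v := by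
      ext x
      constructor
      · rintro ⟨w, hw⟩
        induction w with
        | nil => exact mem_cluster_self _ _
        | cons h p ih =>
          simp only [SimpleGraph.Walk.support_cons, List.mem_cons, forall_eq_or_imp] at hw
          have h2 := hw.2 _ p.start_mem_support
          exact SimpleGraph.Reachable.trans
            (openGraph_off_adj.2 ⟨h, hv, h2⟩ : (openGraph G (off S ω)).Adj _ _).reachable
            (ih h2 hw.2)
      · rintro ⟨w⟩
        induction w with
        | nil => exact ⟨SimpleGraph.Walk.nil, by simpa using hv⟩
        | cons h p ih =>
          rw [openGraph_off_adj] at h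
          obtain ⟨w, hw⟩ := ih h.2.2
          exact ⟨SimpleGraph.Walk.cons h.1 w, by simpa using ⟨hv, hw⟩⟩
    rw [connectedToInfinityOff, ← this]
    rfl

theorem determinedBy_connectedToInfinityOff (S : Set V) (v : V) :
    DeterminedBy (connectedToInfinityOff G S v) (touching G S)ᶜ := by
  intro ω ω' h hω
  rw [mem_connectedToInfinityOff] at hω ⊢
  rwa [← off_congr h]

theorem connectedToInfinityOff_mono {S : Set V} {v : V} {ω ω' : Configuration G}
    (h : ∀ e, ω e = true → ω' e = true) (hω : ω ∈ connectedToInfinityOff G S v) :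
    ω' ∈ connectedToInfinityOff G S v := by
  rw [mem_connectedToInfinityOff] at hω ⊢
  exact hω.mono (cluster_mono (off_mono S h) v)

/-- Exploring the cluster from `S` inspects only edges touching what has been reached. Everything
off `T` stays unexplored, hence independent of this event. -/
theorem determinedBy_clusterOf_eq (S T : Set V) :
    DeterminedBy {ω : Configuration G | clusterOf G ω S = T} (touching G T) := by
  rintro ω ω' h rfl
  have key : ∀ x ∈ clusterOf G ω S, ∀ y, (openGraph G ω).Adj x y ↔ (openGraph G ω').Adj x y := by
    intro x hx y
    simp only [openGraph_adj]
    exact exists_congr fun hxy ↦ by rw [h _ (mem_touching_left hxy hx)]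
  apply Set.Subset.antisymm
  · rintro x ⟨v, hv, hx⟩
    exact mem_of_reachable (fun x hx y hxy ↦ mem_clusterOf_of_adj hx ((key x hx y).2 hxy))
      (subset_clusterOf ω S hv) hx
  · rintro x ⟨v, hv, hx⟩
    -- Following an `ω`-path inside the intersection of both clusters is what allows each step to be
    -- transferred to `ω'`.
    refine (mem_of_reachable (H := openGraph G ω) (T := clusterOf G ω S ∩ clusterOf G ω' S)
      (fun x hx y hxy ↦ ⟨mem_clusterOf_of_adj hx.1 hxy,
        mem_clusterOf_of_adj hx.2 ((key x hx.1 y).1 hxy)⟩)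
      ⟨subset_clusterOf ω S hv, subset_clusterOf ω' S hv⟩ hx).2

/-! ### Local finiteness and measurability -/

theorem countable_of_connected [G.LocallyFinite] (h : G.Connected) : Countable V := by
  obtain ⟨v₀⟩ := h.nonempty
  have hfin : ∀ (n : ℕ) (v : V), {x | ∃ w : G.Walk v x, w.length = n}.Finite := by
    intro n
    induction n with
    | zero =>
      intro v
      refine (Set.finite_singleton v).subset ?_
      rintro x ⟨w, hw⟩
      exact (SimpleGraph.Walk.eq_of_length_eq_zero hw).symm
    | succ n ih =>
      intro v
      refine ((G.neighborSet v).toFinite.biUnion fun u _ ↦ ih u).subset ?_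
      rintro x ⟨w, hw⟩
      cases w with
      | nil => simp at hw
      | cons hadj p =>
        simp only [Set.mem_iUnion]
        exact ⟨_, hadj, p, by simpa using hw⟩
  have : (Set.univ : Set V) ⊆ ⋃ n, {x | ∃ w : G.Walk v₀ x, w.length = n} := by
    intro x _
    obtain ⟨w⟩ := h.preconnected v₀ x
    exact Set.mem_iUnion.2 ⟨w.length, w, rfl⟩
  exact Set.countable_univ_iff.1
    ((Set.countable_iUnion fun n ↦ (hfin n v₀).countable).mono this)

theorem finite_touching [G.LocallyFinite] {T : Set V} (hT : T.Finite) : (touching G T).Finite := by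
  refine Set.Finite.of_finite_image (f := Subtype.val) ?_ Subtype.val_injective.injOn
  refine (hT.biUnion fun x _ ↦ ((G.neighborSet x).toFinite.image fun y ↦ s(x, y))).subset ?_
  rintro _ ⟨⟨e, he⟩, ⟨x, hx, hxT⟩, rfl⟩
  simp only [Set.mem_iUnion]
  obtain ⟨y, rfl⟩ := Sym2.mem_iff_exists.1 hx
  exact ⟨x, hxT, y, he, rfl⟩

theorem measurableSet_clusterOf_eq [G.LocallyFinite] (S : Set V) (T : Finset V) :
    MeasurableSet {ω : Configuration G | clusterOf G ω S = T} :=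
  (determinedBy_clusterOf_eq S T).measurableSet (finite_touching T.finite_toSet)

theorem measurableSet_clusterOf_finite [Countable V] [G.LocallyFinite] (S : Set V) :
    MeasurableSet {ω : Configuration G | (clusterOf G ω S).Finite} := by
  have : {ω : Configuration G | (clusterOf G ω S).Finite} =
      ⋃ T : Finset V, {ω | clusterOf G ω S = T} := by
    ext ω
    simp only [Set.mem_ofPred_eq, Set.mem_iUnion]
    exact ⟨fun h ↦ ⟨h.toFinset, by simp⟩, fun ⟨T, hT⟩ ↦ hT ▸ T.finite_toSet⟩
  rw [this]
  exact MeasurableSet.iUnion fun T ↦ measurableSet_clusterOf_eq S T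

theorem measurableSet_cluster_eq [G.LocallyFinite] (v : V) (T : Finset V) :
    MeasurableSet {ω : Configuration G | cluster G ω v = T} := by
  simpa only [clusterOf_singleton] using measurableSet_clusterOf_eq (G := G) {v} T

theorem measurableSet_cluster_finite [Countable V] [G.LocallyFinite] (v : V) :
    MeasurableSet {ω : Configuration G | (cluster G ω v).Finite} := by
  simpa only [clusterOf_singleton] using measurableSet_clusterOf_finite (G := G) {v}

theorem measurableSet_cluster_infinite [Countable V] [G.LocallyFinite] (v : V) :
    MeasurableSet {ω : Configuration G | (cluster G ω v).Infinite} :=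
  (measurableSet_cluster_finite v).compl

theorem measurableSet_connectedToInfinity [Countable V] [G.LocallyFinite] (S : Set V) :
    MeasurableSet (connectedToInfinity G S) := by
  have : connectedToInfinity G S = ⋃ v ∈ S, {ω | (cluster G ω v).Infinite} := by
    ext ω; simp [connectedToInfinity]
  rw [this]
  exact MeasurableSet.biUnion S.to_countable fun v _ ↦ measurableSet_cluster_infinite v

theorem measurableSet_connectedToInfinityOff [Countable V] [G.LocallyFinite] (S : Set V) (v : V) :
    MeasurableSet (connectedToInfinityOff G S v) := by
  have : connectedToInfinityOff G S v = off S ⁻¹' {ω | (cluster G ω v).Infinite} := by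
    ext ω; exact mem_connectedToInfinityOff
  rw [this]
  exact measurable_off S (measurableSet_cluster_infinite v)

/-! ### The oriented boundary -/

theorem finite_boundaryDarts [G.LocallyFinite] (S : Finset V) :
    {d : G.Dart | d.fst ∈ S ∧ d.snd ∉ S}.Finite := by
  refine Set.Finite.of_finite_image (f := fun d : G.Dart ↦ d.toProd) ?_
    (SimpleGraph.Dart.toProd_injective).injOn
  refine (S.finite_toSet.biUnion fun x _ ↦
    ((G.neighborSet x).toFinite.image fun y ↦ (x, y))).subset ?_
  rintro _ ⟨d, ⟨h1, h2⟩, rfl⟩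
  simp only [Set.mem_iUnion]
  exact ⟨d.fst, h1, d.snd, d.adj, rfl⟩

/-- The oriented edges that lead out of `S`. -/
noncomputable def boundaryDarts (G : SimpleGraph V) [G.LocallyFinite] (S : Finset V) :
    Finset G.Dart :=
  (finite_boundaryDarts S).toFinset

theorem mem_boundaryDarts [G.LocallyFinite] {S : Finset V} {d : G.Dart} :
    d ∈ boundaryDarts G S ↔ d.fst ∈ S ∧ d.snd ∉ S := by
  simp [boundaryDarts]

open Classical in
theorem sum_boundaryDarts [G.LocallyFinite] (S : Finset V) (f : V → ℝ) :
    ∑ a ∈ S, ∑ b ∈ G.neighborFinset a \ S, f b = ∑ d ∈ boundaryDarts G S, f d.snd := by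
  rw [Finset.sum_sigma']
  symm
  refine Finset.sum_bij (fun d _ ↦ ⟨d.fst, d.snd⟩) ?_ ?_ ?_ ?_
  · intro d hd
    rw [mem_boundaryDarts] at hd
    simp only [Finset.mem_sigma, Finset.mem_sdiff, SimpleGraph.mem_neighborFinset]
    exact ⟨hd.1, d.adj, hd.2⟩
  · intro d _ d' _ h
    simp only [Sigma.mk.injEq, heq_eq_eq] at h
    exact SimpleGraph.Dart.toProd_injective (Prod.ext h.1 h.2)
  · rintro ⟨a, b⟩ hab
    simp only [Finset.mem_sigma, Finset.mem_sdiff, SimpleGraph.mem_neighborFinset] at hab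
    exact ⟨⟨(a, b), hab.2.1⟩, mem_boundaryDarts.2 ⟨hab.1, hab.2.2⟩, rfl⟩
  · intro d _
    rfl

/-- The unoriented edge of a dart. -/
def dartEdge (d : G.Dart) : G.edgeSet := ⟨d.edge, d.edge_mem⟩

theorem openGraph_adj_dart {ω : Configuration G} (d : G.Dart) :
    (openGraph G ω).Adj d.fst d.snd ↔ ω (dartEdge d) = true :=
  ⟨fun h ↦ h.2, fun h ↦ ⟨d.adj, h⟩⟩

theorem dartEdge_mem_touching {T : Set V} {d : G.Dart} (h : d.fst ∈ T) :
    dartEdge d ∈ touching G T :=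
  mem_touching_left d.adj h

/-- The only other dart on the same edge is the reversal, which starts outside `S`. Counting
boundary darts is thus counting edges. -/
theorem dartEdge_injOn [G.LocallyFinite] (S : Finset V) :
    Set.InjOn (dartEdge (G := G)) (boundaryDarts G S) := by
  intro d hd d' hd' h
  rcases (SimpleGraph.dart_edge_eq_iff d d').1 (congrArg Subtype.val h) with h | h
  · exact h
  · rw [Finset.mem_coe, mem_boundaryDarts] at hd hd'
    subst h
    exact absurd hd'.1 hd.2

/-- The cluster of a finite set is finite if all boundary edges that lead to infinity are closed. -/
theorem clusterOf_finite_of_closed [G.LocallyFinite] {ω : Configuration G} {T : Finset V}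
    (h : ∀ d ∈ boundaryDarts G T, ω ∈ connectedToInfinityOff G T d.snd →
      ω (dartEdge d) = false) : (clusterOf G ω T).Finite := by
  classical
  refine ((T.finite_toSet).union (((boundaryDarts G T).filter
    (ω ∉ connectedToInfinityOff G T ·.snd)).finite_toSet.biUnion
      (t := fun d ↦ cluster G (off T ω) d.snd) ?_)).subset ?_
  · intro d hd
    have := (Finset.mem_filter.1 hd).2
    rwa [mem_connectedToInfinityOff, Set.not_infinite] at this
  · rintro x ⟨v, hv, hx⟩
    refine mem_of_reachable ?_ (Set.mem_union_left _ hv) hx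
    intro x hx y hxy
    by_cases hy : y ∈ T
    · exact Or.inl hy
    right
    simp only [Set.mem_iUnion]
    by_cases hxT : x ∈ T
    · let d : G.Dart := ⟨(x, y), hxy.1⟩
      have hd : d ∈ boundaryDarts G T := mem_boundaryDarts.2 ⟨hxT, hy⟩
      refine ⟨d, ?_, mem_cluster_self _ _⟩
      simp only [Finset.coe_filter, Set.mem_ofPred_eq]
      refine ⟨hd, fun hinf ↦ ?_⟩
      have h1 := (openGraph_adj_dart d).1 hxy
      rw [h d hd hinf] at h1
      exact Bool.false_ne_true h1
    · rcases hx with hx | hx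
      · exact absurd hx hxT
      simp only [Set.mem_iUnion] at hx
      obtain ⟨d, hd, hx⟩ := hx
      exact ⟨d, hd, mem_cluster_of_adj hx (openGraph_off_adj.2 ⟨hxy, hxT, hy⟩)⟩

/-- If sprinkling does not connect `S` to infinity, then it does not open any boundary edge of the
cluster of `S` that leads to infinity. -/
theorem closed_of_clusterOf_superpose_finite [G.LocallyFinite] {ω η : Configuration G} {S : Set V}
    {T : Finset V} (hT : clusterOf G ω S = T) (h : (clusterOf G (superpose (ω, η)) S).Finite)
    {d : G.Dart} (hd : d ∈ boundaryDarts G T) (hω : ω ∈ connectedToInfinityOff G T d.snd) :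
    η (dartEdge d) = false := by
  by_contra hη
  have hle : ∀ e, ω e = true → superpose (ω, η) e = true := fun e he ↦ by simp [superpose, he]
  rw [mem_connectedToInfinityOff] at hω
  refine hω (h.subset ?_)
  have h1 : d.fst ∈ clusterOf G (superpose (ω, η)) S := by
    refine clusterOf_mono hle S ?_
    rw [hT]
    exact (mem_boundaryDarts.1 hd).1
  have h2 : d.snd ∈ clusterOf G (superpose (ω, η)) S := by
    refine mem_clusterOf_of_adj h1 ((openGraph_adj_dart d).2 ?_)
    simp only [superpose]
    simp [Bool.eq_true_of_not_eq_false hη]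
  intro x hx
  refine mem_of_reachable (fun x hx y hxy ↦ mem_clusterOf_of_adj hx ?_) h2 hx
  exact openGraph_mono hle (openGraph_off_adj.1 hxy).1

/-! ### Retention probabilities and monotonicity -/

theorem criticalProbability_nonneg (G : SimpleGraph V) : 0 ≤ criticalProbability G := by
  refine Real.sInf_nonneg ?_
  rintro _ ⟨p, rfl, _⟩
  exact p.2.1

theorem exists_unitInterval_between {a : ℝ} (ha : 0 ≤ a) (p : I) (h : a < p) :
    ∃ q : I, a < q ∧ q < p := by
  refine ⟨⟨(a + p) / 2, by linarith [p.2.1], by linarith [p.2.2]⟩, ?_, ?_⟩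
  · show a < (a + p) / 2
    linarith
  · show (a + p) / 2 < (p : ℝ)
    linarith

theorem exists_sprinkling {p q : I} (h : p < q) :
    ∃ δ : I, 0 < (δ : ℝ) ∧ 1 - (q : ℝ) = (1 - p) * (1 - δ) := by
  have hpq : (p : ℝ) < q := h
  have hp : 0 < 1 - (p : ℝ) := by linarith [q.2.2]
  refine ⟨⟨(q - p) / (1 - p), by apply div_nonneg <;> linarith,
    by rw [div_le_one hp]; linarith [q.2.2]⟩, ?_, ?_⟩
  · show 0 < ((q : ℝ) - p) / (1 - p)
    apply div_pos <;> linarith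
  · show 1 - (q : ℝ) = (1 - p) * (1 - (q - p) / (1 - p))
    field_simp
    ring

theorem le_superpose (x : Configuration G × Configuration G) (e : G.edgeSet) (he : x.1 e = true) :
    superpose x e = true := by
  simp [superpose, he]

/-- The probability of an increasing event is increasing in the retention probability. -/
theorem bondMeasure_real_mono {X : Set (Configuration G)} (mX : MeasurableSet X)
    (hX : ∀ ω ω' : Configuration G, (∀ e, ω e = true → ω' e = true) → ω ∈ X → ω' ∈ X) {p q : I}
    (h : p ≤ q) : (bondMeasure G p).real X ≤ (bondMeasure G q).real X := by
  rcases h.eq_or_lt with rfl | h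
  · rfl
  obtain ⟨δ, -, hδ⟩ := exists_sprinkling h
  rw [← map_superpose (G := G) hδ, map_measureReal_apply measurable_superpose mX]
  calc (bondMeasure G p).real X
      = ((bondMeasure G p).prod (bondMeasure G δ)).real (X ×ˢ Set.univ) := by
        rw [measureReal_prod_prod]; simp
    _ ≤ _ := measureReal_mono fun x hx ↦ hX _ _ (le_superpose x) hx.1

theorem connectedToInfinity_mono (S : Set V) (ω ω' : Configuration G)
    (h : ∀ e, ω e = true → ω' e = true) (hω : ω ∈ connectedToInfinity G S) :
    ω' ∈ connectedToInfinity G S := by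
  obtain ⟨v, hv, hω⟩ := hω
  exact ⟨v, hv, hω.mono (cluster_mono h v)⟩

/-- The probability that a set is not connected to infinity is decreasing. -/
theorem bondMeasure_real_compl_connectedToInfinity_anti [Countable V] [G.LocallyFinite] (S : Set V)
    {p q : I} (h : p ≤ q) : (bondMeasure G q).real (connectedToInfinity G S)ᶜ ≤
      (bondMeasure G p).real (connectedToInfinity G S)ᶜ := by
  rw [probReal_compl_eq_one_sub (measurableSet_connectedToInfinity S),
    probReal_compl_eq_one_sub (measurableSet_connectedToInfinity S)]
  have := bondMeasure_real_mono (measurableSet_connectedToInfinity (G := G) S)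
    (connectedToInfinity_mono S) h
  linarith

/-! ### The number of boundary edges that lead to infinity -/

/-- The number of oriented boundary edges `d` of `S` such that the endpoint of `d` outside of `S`
is connected to infinity off `S`. -/
noncomputable def escapes (G : SimpleGraph V) [G.LocallyFinite] (S : Finset V)
    (ω : Configuration G) : ℕ :=
  occurring (boundaryDarts G S) (fun d ↦ connectedToInfinityOff G S d.snd) ω

/-- The expected number of boundary edges that lead to infinity. -/
noncomputable def meanEscapes (G : SimpleGraph V) [G.LocallyFinite] (p : I) (S : Finset V) : ℝ :=
  ∑ d ∈ boundaryDarts G S, (bondMeasure G p).real (connectedToInfinityOff G S d.snd)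

open Classical in
theorem sum_eq_meanEscapes [G.LocallyFinite] (p : I) (S : Finset V) :
    ∑ a ∈ S, ∑ b ∈ G.neighborFinset a \ S,
      (bondMeasure G p).real (connectedToInfinityOff G (S : Set V) b) = meanEscapes G p S :=
  sum_boundaryDarts S _

theorem boundaryBound_iff [G.LocallyFinite] {p₀ : ℝ} {d : EReal} :
    BoundaryBound G p₀ d ↔ ∀ p : I, p₀ < p → ∀ d' : ℝ, 1 < d' → (d' : EReal) < d →
      ∃ c : ℝ, 0 < c ∧ ∀ S : Finset V, S.Nonempty →
        c * (S.card : ℝ) ^ ((d' - 1) / d') ≤ meanEscapes G p S := by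
  simp only [BoundaryBound, sum_eq_meanEscapes]

section

variable [Countable V] [G.LocallyFinite]

theorem meanEscapes_mono {p q : I} (h : p ≤ q) (S : Finset V) :
    meanEscapes G p S ≤ meanEscapes G q S :=
  Finset.sum_le_sum fun _ _ ↦ bondMeasure_real_mono (measurableSet_connectedToInfinityOff _ _)
    (fun _ _ hω ↦ connectedToInfinityOff_mono hω) h

theorem integral_escapes (p : I) (S : Finset V) :
    ∫ ω, (escapes G S ω : ℝ) ∂(bondMeasure G p) = meanEscapes G p S :=
  integral_occurring _ _ fun _ ↦ measurableSet_connectedToInfinityOff _ _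

theorem measurable_escapes (S : Finset V) : Measurable (escapes G S) :=
  measurable_occurring _ fun _ ↦ measurableSet_connectedToInfinityOff _ _

theorem integrable_escapes (p : I) (S : Finset V) :
    Integrable (fun ω ↦ (escapes G S ω : ℝ)) (bondMeasure G p) :=
  integrable_occurring _ _ fun _ ↦ measurableSet_connectedToInfinityOff _ _

theorem integrable_pow_escapes (p : I) (S : Finset V) {a : ℝ} (h0 : 0 ≤ a) (h1 : a ≤ 1) :
    Integrable (fun ω ↦ a ^ escapes G S ω) (bondMeasure G p) :=
  integrable_pow_occurring _ _ (fun _ ↦ measurableSet_connectedToInfinityOff _ _) h0 h1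

/-- A set is disconnected from infinity as soon as all its boundary edges that lead to infinity
are closed. -/
theorem integral_pow_escapes_le (p : I) (S : Finset V) :
    ∫ ω, (1 - (p : ℝ)) ^ escapes G S ω ∂(bondMeasure G p) ≤
      (bondMeasure G p).real (connectedToInfinity G S)ᶜ := by
  have h1 := real_prod_closing (bondMeasure G p) (boundaryDarts G S)
    (X := fun d ↦ connectedToInfinityOff G S d.snd)
    (fun d ↦ measurableSet_connectedToInfinityOff _ _) (dartEdge_injOn S) p
  -- Edges touching `S` are read from the second copy, all others from the first: the first copy
  -- decides which boundary edges escape, and the second closes them.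
  have h2 : (bondMeasure G p).real (connectedToInfinity G S)ᶜ = ((bondMeasure G p).prod
      (bondMeasure G p)).real (splice (touching G S)ᶜ ⁻¹' (connectedToInfinity G S)ᶜ) := by
    rw [← map_measureReal_apply (measurable_splice _)
      (measurableSet_connectedToInfinity _).compl, map_splice]
  rw [h2]
  unfold escapes
  rw [← h1]
  refine measureReal_mono fun x hx ↦ ?_
  show splice (touching G S)ᶜ x ∉ connectedToInfinity G S
  rw [notMem_connectedToInfinity_iff S.finite_toSet]
  refine clusterOf_finite_of_closed fun d hd hω ↦ ?_
  rw [splice_of_notMem (not_not.2 (dartEdge_mem_touching (mem_boundaryDarts.1 hd).1))]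
  refine hx d hd (((determinedBy_connectedToInfinityOff _ _).iff fun e he ↦ ?_).1 hω)
  exact splice_of_mem he x

/-- Jensen's inequality for the exponential, in the form of the tangent line at the mean. -/
theorem pow_meanEscapes_le (p : I) (hp : (p : ℝ) < 1) (S : Finset V) :
    Real.exp (Real.log (1 - p) * meanEscapes G p S) ≤
      (bondMeasure G p).real (connectedToInfinity G S)ᶜ := by
  refine le_trans ?_ (integral_pow_escapes_le p S)
  have hp' : 0 < 1 - (p : ℝ) := by linarith
  set l := Real.log (1 - p) with hl
  set m := meanEscapes G p S with hm
  -- The integrand is the tangent line of `exp` at `l * m`, evaluated at `l * escapes`; its linear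
  -- part has mean zero.
  have h1 : ∫ ω, Real.exp (l * m) * (1 + (l * (escapes G S ω : ℝ) - l * m))
      ∂(bondMeasure G p) = Real.exp (l * m) := by
    rw [integral_const_mul, integral_add (integrable_const _), integral_sub, integral_const_mul,
      integral_escapes]
    · simp [hm]
    · exact (integrable_escapes p S).const_mul l
    · exact integrable_const _
    · exact ((integrable_escapes p S).const_mul l).sub (integrable_const _)
  rw [← h1]
  refine integral_mono ?_ (integrable_pow_escapes p S hp'.le (by linarith [p.2.1])) fun ω ↦ ?_
  · exact ((integrable_const _).add
      (((integrable_escapes p S).const_mul l).sub (integrable_const _))).const_mul _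
  · have : (1 - (p : ℝ)) ^ escapes G S ω = Real.exp (l * m) *
        Real.exp (l * (escapes G S ω : ℝ) - l * m) := by
      rw [← Real.exp_add, add_sub_cancel, mul_comm, Real.exp_nat_mul, hl, Real.exp_log hp']
    simp only [this]
    gcongr
    linarith [Real.add_one_le_exp (l * (escapes G S ω : ℝ) - l * m)]

/-- The comparison is made at some q < p, where log(1 - q) is finite and negative even if p = 1;
monotonicity of the mean then returns to p. -/
theorem DisconnectionBound.boundaryBound {p₀ : ℝ} (h0 : 0 ≤ p₀) {d : EReal}
    (h : DisconnectionBound G p₀ d) : BoundaryBound G p₀ d := by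
  rw [boundaryBound_iff]
  intro p hp d' hd' hd'd
  obtain ⟨q, hq, hqp⟩ := exists_unitInterval_between h0 p hp
  have hqp' : (q : ℝ) < p := hqp
  have hq1 : (q : ℝ) < 1 := by linarith [p.2.2]
  obtain ⟨c, hc, hS⟩ := h q hq d' hd' hd'd
  have hl : Real.log (1 - q) < 0 := Real.log_neg (by linarith) (by linarith)
  refine ⟨c / -Real.log (1 - q), div_pos hc (by linarith), fun S hne ↦ ?_⟩
  refine le_trans ?_ (meanEscapes_mono hqp.le S)
  have h1 := (pow_meanEscapes_le q hq1 S).trans (hS S hne)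
  rw [Real.exp_le_exp] at h1
  rw [div_mul_eq_mul_div, div_le_iff₀ (by linarith)]
  linarith

/-! ### The effect of sprinkling -/

/-- Each increment lowers the power by δ(1-δ)^n ≥ δ(1-δ)^M. Linearity in n is the point: after
integration only the mean of n enters. -/
theorem one_sub_pow_le {δ : ℝ} (h0 : 0 ≤ δ) (h1 : δ ≤ 1) {n M : ℕ} (hn : n ≤ M) :
    (1 - δ) ^ n ≤ 1 - δ * (1 - δ) ^ M * n := by
  induction n with
  | zero => simp
  | succ n ih =>
    have h2 : (1 - δ) ^ M ≤ (1 - δ) ^ n :=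
      pow_le_pow_of_le_one (by linarith) (by linarith) (by omega)
    have h3 := mul_le_mul_of_nonneg_left h2 h0
    have := ih (by omega)
    push_cast
    rw [pow_succ]
    linarith

/-- Two disjoint parts of "`S` is disconnected before sprinkling" are compared: "still disconnected
afterwards", and "the cluster was some `T ∈ 𝒯` and sprinkling opened an escape of `T`". Restricting
to a finite family gives the bound `M` on boundary sizes. -/
theorem sum_real_clusterOf_mul_le {p δ r : I} (h : 1 - (r : ℝ) = (1 - p) * (1 - δ)) {S : Finset V}
    {B : ℝ} (hB : ∀ T : Finset V, S ⊆ T → B ≤ meanEscapes G p T) (𝒯 : Finset (Finset V)) {M : ℕ}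
    (hM : ∀ T ∈ 𝒯, (boundaryDarts G T).card ≤ M) :
    (bondMeasure G r).real (connectedToInfinity G S)ᶜ +
      (∑ T ∈ 𝒯, (bondMeasure G p).real {ω | clusterOf G ω S = T}) * (δ * (1 - δ) ^ M * B) ≤
      (bondMeasure G p).real (connectedToInfinity G S)ᶜ := by
  classical
  set μ := bondMeasure G p
  set ν := bondMeasure G δ
  let X : Finset V → G.Dart → Set (Configuration G) :=
    fun T d ↦ connectedToInfinityOff G T d.snd
  have mX : ∀ T d, MeasurableSet (X T d) := fun T d ↦ measurableSet_connectedToInfinityOff _ _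
  let Y : Finset V → Set (Configuration G × Configuration G) :=
    fun T ↦ {x | ∀ d ∈ boundaryDarts G T, x.1 ∈ X T d → x.2 (dartEdge d) = false}
  have mY : ∀ T, MeasurableSet (Y T) := fun T ↦ measurableSet_closing _ (mX T) _
  let K : Finset V → Set (Configuration G) := fun T ↦ {ω | clusterOf G ω S = T}
  have mK : ∀ T, MeasurableSet (K T) := fun T ↦ measurableSet_clusterOf_eq _ _
  have mC : MeasurableSet (connectedToInfinity G (S : Set V))ᶜ :=
    (measurableSet_connectedToInfinity _).compl
  have hY : ∀ T, ((μ.prod ν).real (Y T)ᶜ) = 1 - ∫ ω, (1 - (δ : ℝ)) ^ escapes G T ω ∂μ := by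
    intro T
    rw [probReal_compl_eq_one_sub (mY T)]
    congr 1
    exact real_prod_closing μ _ (mX T) (dartEdge_injOn T) δ
  have hterm : ∀ T ∈ 𝒯, μ.real (K T) * (δ * (1 - δ) ^ M * B) ≤
      (μ.prod ν).real ((Y T)ᶜ ∩ Prod.fst ⁻¹' K T) := by
    intro T hT
    by_cases hST : S ⊆ T
    -- For a fixed sprinkling, the event that some escape is opened depends only on edges not
    -- touching `T`, while `K T` depends only on edges touching `T`.
    · rw [real_prod_inter_fst (A := (touching G T)ᶜ) _ _ (mY T).compl (mK T), mul_comm, hY]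
      · refine mul_le_mul_of_nonneg_right ?_ measureReal_nonneg
        have h1 : ∫ ω, (1 - (δ : ℝ)) ^ escapes G T ω ∂μ ≤
            ∫ ω, (1 - δ * (1 - δ) ^ M * (escapes G T ω : ℝ)) ∂μ := by
          refine integral_mono (integrable_pow_escapes p T (by linarith [δ.2.2])
            (by linarith [δ.2.1])) ((integrable_const _).sub
              ((integrable_escapes p T).const_mul _)) fun ω ↦ ?_
          exact one_sub_pow_le δ.2.1 δ.2.2 ((occurring_le_card _ _ _).trans (hM T hT))
        rw [integral_sub (integrable_const _) ((integrable_escapes p T).const_mul _),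
          integral_const_mul, integral_escapes] at h1
        have h2 := mul_le_mul_of_nonneg_left (hB T hST) (a := (δ : ℝ) * (1 - δ) ^ M)
          (mul_nonneg δ.2.1 (pow_nonneg (by linarith [δ.2.2]) _))
        simp only [integral_const, probReal_univ, smul_eq_mul, mul_one] at h1
        linarith
      · intro η ω ω' hω hY' hY''
        refine hY' fun d hd hd' ↦ hY'' d hd ?_
        exact (determinedBy_connectedToInfinityOff _ _) hω hd'
      · rw [compl_compl]
        exact determinedBy_clusterOf_eq _ _
    · have : K T = ∅ := by
        refine Set.eq_empty_of_forall_notMem fun ω hω ↦ hST ?_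
        have h1 : clusterOf G ω S = T := hω
        have h2 := subset_clusterOf ω (S : Set V)
        rw [h1] at h2
        exact_mod_cast h2
      simp [this]
  have hdisj : Set.PairwiseDisjoint (𝒯 : Set (Finset V))
      (fun T ↦ (Y T)ᶜ ∩ Prod.fst ⁻¹' K T) := by
    intro T _ T' _ hne
    refine Set.disjoint_left.2 fun x hx hx' ↦ hne ?_
    have h1 : clusterOf G x.1 S = T := hx.2
    have h2 : clusterOf G x.1 S = T' := hx'.2
    exact_mod_cast h1.symm.trans h2
  have hsum : (∑ T ∈ 𝒯, μ.real (K T)) * (δ * (1 - δ) ^ M * B) ≤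
      (μ.prod ν).real (⋃ T ∈ 𝒯, (Y T)ᶜ ∩ Prod.fst ⁻¹' K T) := by
    rw [measureReal_biUnion_finset hdisj fun T _ ↦ (mY T).compl.inter (measurable_fst (mK T)),
      Finset.sum_mul]
    exact Finset.sum_le_sum hterm
  have hr : (bondMeasure G r).real (connectedToInfinity G S)ᶜ =
      (μ.prod ν).real (superpose ⁻¹' (connectedToInfinity G S)ᶜ) := by
    rw [← map_superpose (G := G) h, map_measureReal_apply measurable_superpose mC]
  have hp : μ.real (connectedToInfinity G S)ᶜ =
      (μ.prod ν).real ((connectedToInfinity G S)ᶜ ×ˢ Set.univ) := by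
    rw [measureReal_prod_prod]; simp
  rw [hr, hp]
  refine (add_le_add_right hsum _).trans ?_
  rw [← measureReal_union (h₁ := measure_ne_top _ _) (h₂ := measure_ne_top _ _)]
  · refine measureReal_mono ?_
    rintro x (hx | hx)
    · exact ⟨fun hx' ↦ hx (connectedToInfinity_mono _ _ _ (le_superpose x) hx'), trivial⟩
    · simp only [Set.mem_iUnion] at hx
      obtain ⟨T, -, -, hx⟩ := hx
      refine ⟨(notMem_connectedToInfinity_iff S.finite_toSet).2 ?_, trivial⟩
      have h1 : clusterOf G x.1 S = T := hx
      rw [h1]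
      exact T.finite_toSet
  · refine Set.disjoint_left.2 fun x hx hx' ↦ ?_
    simp only [Set.mem_iUnion] at hx'
    obtain ⟨T, -, hx', hxT⟩ := hx'
    refine hx' fun d hd hω ↦ ?_
    exact closed_of_clusterOf_superpose_finite hxT
      ((notMem_connectedToInfinity_iff S.finite_toSet).1 hx) hd hω
  · exact 𝒯.measurableSet_biUnion fun T _ ↦ (mY T).compl.inter (measurable_fst (mK T))

theorem hasSum_real_iUnion {α ι : Type*} [MeasurableSpace α] [Countable ι] (μ : Measure α)
    [IsFiniteMeasure μ] {A : ι → Set α} (hA : ∀ i, MeasurableSet (A i))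
    (hdisj : Pairwise (Function.onFun Disjoint A)) :
    HasSum (fun i ↦ μ.real (A i)) (μ.real (⋃ i, A i)) := by
  have h := measure_iUnion (μ := μ) hdisj hA
  rw [measureReal_def, h, ENNReal.tsum_toReal_eq fun i ↦ measure_ne_top _ _]
  refine ENNReal.hasSum_toReal ?_
  rw [← h]
  exact measure_ne_top _ _

theorem hasSum_real_clusterOf_eq (p : I) (S : Finset V) :
    HasSum (fun T : Finset V ↦ (bondMeasure G p).real {ω | clusterOf G ω S = T})
      ((bondMeasure G p).real (connectedToInfinity G S)ᶜ) := by
  have h : (connectedToInfinity G (S : Set V))ᶜ = ⋃ T : Finset V, {ω | clusterOf G ω S = T} := by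
    ext ω
    rw [Set.mem_compl_iff, notMem_connectedToInfinity_iff S.finite_toSet, Set.mem_iUnion]
    exact ⟨fun h ↦ ⟨h.toFinset, by simp⟩, fun ⟨T, hT⟩ ↦ hT ▸ T.finite_toSet⟩
  rw [h]
  refine hasSum_real_iUnion _ (fun T ↦ measurableSet_clusterOf_eq _ _) ?_
  intro T T' hne
  refine Set.disjoint_left.2 fun ω hω hω' ↦ hne ?_
  have h1 : clusterOf G ω S = T := hω
  have h2 : clusterOf G ω S = T' := hω'
  exact_mod_cast h1.symm.trans h2

end

/-! ### Integrating the sprinkling inequality over time -/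

/-- A nonnegative antitone function that decays at exponential rate at least `k` locally to the
right of each point does so globally. -/
theorem le_mul_exp_of_local_decay {F : ℝ → ℝ} {a b k : ℝ} (hab : a ≤ b)
    (hF : AntitoneOn F (Set.Icc a b))
    (hloc : ∀ t ∈ Set.Ico a b, ∃ s, 0 < s ∧ t + s ≤ b ∧ F (t + s) ≤ F t * Real.exp (-(k * s))) :
    F b ≤ F a * Real.exp (-(k * (b - a))) := by
  -- Continuous induction: the supremum of the times at which the bound holds is again such a time
  -- (`F` is antitone, the bound is continuous), and local decay would push it further if it were
  -- below `b`.
  set A := {t | t ∈ Set.Icc a b ∧ F t ≤ F a * Real.exp (-(k * (t - a)))} with hA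
  have haA : a ∈ A := ⟨⟨le_rfl, hab⟩, by simp⟩
  have hbdd : BddAbove A := ⟨b, fun t ht ↦ ht.1.2⟩
  have hlub := isLUB_csSup ⟨a, haA⟩ hbdd
  set u := sSup A with hu
  have hau : a ≤ u := hlub.1 haA
  have hub : u ≤ b := hlub.2 fun t ht ↦ ht.1.2
  have huA : u ∈ A := by
    refine ⟨⟨hau, hub⟩, ?_⟩
    obtain ⟨t, -, -, ht, htA⟩ := hlub.exists_seq_monotone_tendsto ⟨a, haA⟩
    have hc : Continuous fun t ↦ F a * Real.exp (-(k * (t - a))) := by fun_prop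
    refine ge_of_tendsto ((hc.tendsto u).comp ht) (Filter.Eventually.of_forall fun n ↦ ?_)
    exact (hF (htA n).1 ⟨hau, hub⟩ (hlub.1 (htA n))).trans (htA n).2
  rcases hub.eq_or_lt with h | h
  · rw [h] at huA
    exact huA.2
  · obtain ⟨s, hs, hsb, hFs⟩ := hloc u ⟨hau, h⟩
    have : u + s ∈ A := by
      refine ⟨⟨by linarith, hsb⟩, hFs.trans ?_⟩
      refine (mul_le_mul_of_nonneg_right huA.2 (Real.exp_nonneg _)).trans_eq ?_
      rw [mul_assoc, ← Real.exp_add]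
      ring_nf
    linarith [hlub.1 this]

/-- The retention probability `1 - exp (-|t|)`. -/
noncomputable def retention (t : ℝ) : I :=
  -- The absolute value only makes the definition total. For nonnegative times, sprinkling becomes
  -- addition of times.
  ⟨1 - Real.exp (-|t|), by simp, by simp [Real.exp_nonneg]⟩

theorem one_sub_retention {t : ℝ} (ht : 0 ≤ t) : 1 - (retention t : ℝ) = Real.exp (-t) := by
  simp [retention, abs_of_nonneg ht]

theorem retention_mono {s t : ℝ} (hs : 0 ≤ s) (h : s ≤ t) : retention s ≤ retention t := by
  have h1 := one_sub_retention hs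
  have h2 := one_sub_retention (hs.trans h)
  have h3 : Real.exp (-t) ≤ Real.exp (-s) := Real.exp_le_exp.2 (by linarith)
  exact Subtype.coe_le_coe.1 (by linarith)

theorem retention_neg_log {p : I} (hp : (p : ℝ) < 1) : retention (-Real.log (1 - p)) = p := by
  have h : Real.log (1 - p) ≤ 0 := Real.log_nonpos (by linarith) (by linarith [p.2.1])
  have h1 := one_sub_retention (t := -Real.log (1 - p)) (by linarith)
  rw [neg_neg, Real.exp_log (by linarith)] at h1
  exact Subtype.ext (by linarith)

/-- Since 1 - e^(-s) ≥ s e^(-s), the product is at least s e^(-s(M+1)) ≥ s(1 - s(M+1)), and s(M+1) ≤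
1/3. -/
theorem exists_sprinkling_time (M : ℕ) {s : ℝ} (hs : 0 < s) (hs' : s * (3 * (M + 1)) ≤ 1) :
    2 / 3 * s ≤ (retention s : ℝ) * (1 - (retention s : ℝ)) ^ M := by
  have h1 := one_sub_retention hs.le
  have h2 : s * Real.exp (-s) ≤ retention s := by
    have h3 : (retention s : ℝ) = 1 - Real.exp (-s) := by linarith
    have h4 : (s + 1) * Real.exp (-s) ≤ 1 := by
      calc (s + 1) * Real.exp (-s) ≤ Real.exp s * Real.exp (-s) := by
            gcongr; exact Real.add_one_le_exp s
        _ = 1 := by rw [← Real.exp_add]; simp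
    rw [h3]; linarith
  calc 2 / 3 * s ≤ s * (1 + -(s * (M + 1))) := by nlinarith
    _ ≤ s * Real.exp (-(s * (M + 1))) := by
      gcongr; linarith [Real.add_one_le_exp (-(s * ((M : ℝ) + 1)))]
    _ = s * Real.exp (-s) * Real.exp (-s) ^ M := by
      rw [mul_assoc, ← Real.exp_nat_mul, ← Real.exp_add]; ring_nf
    _ ≤ _ := by rw [h1]; gcongr

/-- The lower bound `B` is required for all supersets of `S` because the cluster of `S` plays the
role of `T`. It persists at all later times by monotonicity of the mean. -/
theorem real_compl_connectedToInfinity_le [Countable V] [G.LocallyFinite] {S : Finset V} {B : ℝ}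
    (hB0 : 0 ≤ B) {p q : I} (hpq : p ≤ q) (hq : (q : ℝ) < 1)
    (hB : ∀ T : Finset V, S ⊆ T → B ≤ meanEscapes G p T) :
    (bondMeasure G q).real (connectedToInfinity G S)ᶜ ≤
      Real.exp (-(B / 2 * (Real.log (1 - p) - Real.log (1 - q)))) := by
  have hpq' : (p : ℝ) ≤ q := hpq
  set a := -Real.log (1 - p) with ha
  set b := -Real.log (1 - q) with hb
  have ha0 : 0 ≤ a := by
    have : Real.log (1 - p) ≤ 0 := Real.log_nonpos (by linarith) (by linarith [p.2.1])
    linarith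
  have hab : a ≤ b := by
    have : Real.log (1 - q) ≤ Real.log (1 - p) := Real.log_le_log (by linarith) (by linarith)
    linarith
  set F : ℝ → ℝ := fun t ↦ (bondMeasure G (retention t)).real (connectedToInfinity G S)ᶜ with hF
  have hFb : F b = (bondMeasure G q).real (connectedToInfinity G S)ᶜ := by
    simp only [hF, hb, retention_neg_log hq]
  have hFanti : AntitoneOn F (Set.Icc a b) := fun s hs t _ hst ↦
    bondMeasure_real_compl_connectedToInfinity_anti _ (retention_mono (ha0.trans hs.1) hst)
  have hmain := le_mul_exp_of_local_decay (k := B / 2) hab hFanti ?_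
  · rw [hFb] at hmain
    refine hmain.trans ?_
    refine (mul_le_of_le_one_left (Real.exp_nonneg _) measureReal_le_one).trans_eq ?_
    rw [ha, hb]
    ring_nf
  intro t ht
  have ht0 : 0 ≤ t := ha0.trans ht.1
  rcases (show 0 ≤ F t from measureReal_nonneg).eq_or_lt with h0 | h0
  · refine ⟨b - t, by linarith [ht.2], by linarith, ?_⟩
    have h1 : F (t + (b - t)) ≤ F t :=
      hFanti ⟨ht.1, ht.2.le⟩ ⟨by linarith [ht.1], by linarith⟩ (by linarith [ht.2])
    rw [← h0] at h1 ⊢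
    simpa using h1
  -- A finite family carries at least 3/4 of the disconnection probability. Together with the 2/3
  -- from the sprinkling time this yields the rate `B / 2`.
  obtain ⟨𝒯, h𝒯⟩ := ((hasSum_real_clusterOf_eq (G := G) (retention t) S).eventually_const_lt
    (show 3 / 4 * F t < F t by linarith)).exists
  set M := 𝒯.sup fun T ↦ (boundaryDarts G T).card with hM
  set s := min (b - t) (1 / (3 * ((M : ℝ) + 1))) with hs
  have hs0 : 0 < s := lt_min (by linarith [ht.2]) (by positivity)
  refine ⟨s, hs0, by linarith [min_le_left (b - t) (1 / (3 * ((M : ℝ) + 1)))], ?_⟩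
  have h1 : 2 / 3 * s ≤ _ := exists_sprinkling_time M hs0 (by
    rw [← le_div_iff₀ (by positivity)]; exact min_le_right _ _)
  have hcoup : 1 - (retention (t + s) : ℝ) = (1 - retention t) * (1 - retention s) := by
    rw [one_sub_retention ht0, one_sub_retention hs0.le, one_sub_retention (by linarith),
      ← Real.exp_add]
    ring_nf
  have hpt : p ≤ retention t := by
    rw [← retention_neg_log (p := p) (by linarith)]
    exact retention_mono ha0 ht.1
  have h2 := sum_real_clusterOf_mul_le hcoup
    (fun T hT ↦ (hB T hT).trans (meanEscapes_mono hpt T)) 𝒯 (M := M)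
    (fun T hT ↦ Finset.le_sup (f := fun T ↦ (boundaryDarts G T).card) hT)
  have h3 : 3 / 4 * F t * (2 / 3 * s * B) ≤
      (∑ T ∈ 𝒯, (bondMeasure G (retention t)).real {ω | clusterOf G ω S = T}) *
        (retention s * (1 - retention s) ^ M * B) := by
    refine mul_le_mul h𝒯.le (mul_le_mul_of_nonneg_right h1 hB0) (by positivity) ?_
    exact Finset.sum_nonneg fun _ _ ↦ measureReal_nonneg
  have h4 : F (t + s) ≤ F t * (1 + -(B / 2 * s)) := by
    have h5 : F (t + s) + _ ≤ F t := h2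
    linarith
  refine h4.trans ?_
  gcongr
  linarith [Real.add_one_le_exp (-(B / 2 * s))]

/-- The boundary bound is used at r, the decay is accumulated between r and q < 1, and monotonicity
carries the result to p, which may be 1. -/
theorem BoundaryBound.disconnectionBound [Countable V] [G.LocallyFinite] {p₀ : ℝ} (h0 : 0 ≤ p₀)
    {d : EReal} (h : BoundaryBound G p₀ d) : DisconnectionBound G p₀ d := by
  rw [boundaryBound_iff] at h
  intro p hp d' hd' hd'd
  obtain ⟨q, hq, hqp⟩ := exists_unitInterval_between h0 p hp
  obtain ⟨r, hr, hrq⟩ := exists_unitInterval_between h0 q hq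
  have hqp' : (q : ℝ) < p := hqp
  have hrq' : (r : ℝ) < q := hrq
  have hp1 := p.2.2
  obtain ⟨c, hc, hS⟩ := h r hr d' hd' hd'd
  have hlog : Real.log (1 - q) < Real.log (1 - r) :=
    Real.log_lt_log (by linarith) (by linarith)
  have hα : 0 ≤ (d' - 1) / d' := div_nonneg (by linarith) (by linarith)
  refine ⟨c / 2 * (Real.log (1 - r) - Real.log (1 - q)),
    mul_pos (by positivity) (by linarith), fun S hne ↦ ?_⟩
  refine (bondMeasure_real_compl_connectedToInfinity_anti _ hqp.le).trans
    ((real_compl_connectedToInfinity_le (B := c * (S.card : ℝ) ^ ((d' - 1) / d'))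
      (by positivity) hrq.le (by linarith) fun T hT ↦ ?_).trans_eq (by ring_nf))
  refine le_trans ?_ (hS T (hne.mono hT))
  gcongr

section

/-! ### Cluster repulsion and the volume tail -/

/-- A union bound for events that are compared with disjoint events. -/
theorem real_iUnion_le_of_disjoint {α ι : Type*} [MeasurableSpace α] [Countable ι] (μ : Measure α)
    [IsFiniteMeasure μ] {A C : ι → Set α} (hA : ∀ i, MeasurableSet (A i))
    (hdisj : Pairwise (Function.onFun Disjoint A)) {c : ℝ} (hc : 0 ≤ c)
    (h : ∀ i, μ.real (C i) ≤ c * μ.real (A i)) :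
    μ.real (⋃ i, C i) ≤ c * μ.real (⋃ i, A i) := by
  have h1 : μ (⋃ i, C i) ≤ ENNReal.ofReal c * μ (⋃ i, A i) := by
    rw [measure_iUnion hdisj hA, ← ENNReal.tsum_mul_left]
    refine (measure_iUnion_le C).trans (ENNReal.tsum_le_tsum fun i ↦ ?_)
    rw [← ofReal_measureReal (μ := μ) (s := C i), ← ofReal_measureReal (μ := μ) (s := A i),
      ← ENNReal.ofReal_mul hc]
    exact ENNReal.ofReal_le_ofReal (h i)
  rw [measureReal_def, measureReal_def, ← ENNReal.toReal_ofReal hc, ← ENNReal.toReal_mul]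
  exact ENNReal.toReal_mono (ENNReal.mul_ne_top ENNReal.ofReal_ne_top (measure_ne_top _ _)) h1

theorem pairwise_disjoint_cluster_eq (v : V) :
    Pairwise (Function.onFun Disjoint fun T : Finset V ↦
      {ω : Configuration G | cluster G ω v = T}) := by
  intro T T' hne
  refine Set.disjoint_left.2 fun ω hω hω' ↦ hne ?_
  have h1 : cluster G ω v = T := hω
  have h2 : cluster G ω v = T' := hω'
  exact_mod_cast h1.symm.trans h2

/-- A finite cluster of the larger configuration cannot meet an infinite cluster of the smaller one,
so closing every edge that touches such infinite clusters leaves it unchanged. -/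
theorem cluster_off_eq_of_finite {ω ω' : Configuration G} (h : ∀ e, ω e = true → ω' e = true)
    {v : V} (hv : (cluster G ω' v).Finite) :
    (∀ x ∈ cluster G ω' v, (cluster G ω x).Finite) ∧
      cluster G (off {x | (cluster G ω x).Infinite} ω') v = cluster G ω' v := by
  have h1 : ∀ x ∈ cluster G ω' v, (cluster G ω x).Finite := by
    intro x hx
    refine hv.subset ?_
    rw [← cluster_eq_of_mem hx]
    exact cluster_mono h x
  refine ⟨h1, Set.Subset.antisymm (cluster_mono (off_le _ _) v) fun x hx ↦ ?_⟩
  refine (mem_of_reachable (H := openGraph G ω') (T := cluster G ω' v ∩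
    cluster G (off {x | (cluster G ω x).Infinite} ω') v) ?_
      ⟨mem_cluster_self _ _, mem_cluster_self _ _⟩ hx).2
  rintro x ⟨hx, hx'⟩ y hxy
  have hy := mem_cluster_of_adj hx hxy
  refine ⟨hy, mem_cluster_of_adj hx' (openGraph_off_adj.2 ⟨hxy, ?_, ?_⟩)⟩
  · exact Set.not_infinite.2 (h1 x hx)
  · exact Set.not_infinite.2 (h1 y hy)

variable [G.LocallyFinite]

theorem measurableSet_cluster_superpose_eq (v : V) (T : Finset V) :
    MeasurableSet {x : Configuration G × Configuration G | cluster G (superpose x) v = T} :=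
  measurable_superpose (measurableSet_cluster_eq v T)

variable [Countable V]

/-- Cluster repulsion: given the configuration `ω`, after sprinkling it is unlikely that the cluster
of `v` is finite and has many boundary edges that lead to infinity in `ω`. -/
theorem real_cluster_repulsion_section (δ : I) (ω : Configuration G) (v : V) (m : ℕ) :
    (bondMeasure G δ).real {η | ∃ T : Finset V, cluster G (superpose (ω, η)) v = T ∧
      m ≤ escapes G T ω} ≤ (1 - (δ : ℝ)) ^ m := by
  classical
  set ν := bondMeasure G δ
  set W : Set V := {x | (cluster G ω x).Infinite} with hW
  -- Edges from `T` into infinite `ω`-clusters. They include all escapes, because being connected to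
  -- infinity off `T` implies lying in such a cluster.
  let F : Finset V → Finset G.edgeSet := fun T ↦
    ((boundaryDarts G T).filter (·.snd ∈ W)).image dartEdge
  have hF : ∀ T, escapes G T ω ≤ (F T).card := by
    intro T
    rw [Finset.card_image_of_injOn ((dartEdge_injOn T).mono (by simp +contextual [Set.subset_def]))]
    refine Finset.card_le_card ?_
    intro d hd
    rw [Finset.mem_filter] at hd ⊢
    exact ⟨hd.1, (mem_connectedToInfinityOff.1 hd.2).mono (cluster_mono (off_le _ _) _)⟩
  -- The cluster of `v` under `f η` depends on `η` only through edges not touching `W`, whereas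
  -- every edge in `F T` touches `W`; this makes `A T` and `B T` independent.
  let f : Configuration G → Configuration G := fun η ↦ off W (superpose (ω, η))
  have mf : Measurable f :=
    (measurable_off W).comp (measurable_superpose.comp measurable_prodMk_left)
  let A : Finset V → Set (Configuration G) := fun T ↦ f ⁻¹' {ω | cluster G ω v = T}
  have mA : ∀ T, MeasurableSet (A T) := fun T ↦ mf (measurableSet_cluster_eq v T)
  let B : Finset V → Set (Configuration G) := fun T ↦
    if m ≤ (F T).card then {η | ∀ e ∈ F T, η e = false} else ∅
  have hsub : {η | ∃ T : Finset V, cluster G (superpose (ω, η)) v = T ∧ m ≤ escapes G T ω} ⊆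
      ⋃ T, A T ∩ B T := by
    rintro η ⟨T, hT, hm⟩
    have hfin : (cluster G (superpose (ω, η)) v).Finite := by rw [hT]; exact T.finite_toSet
    obtain ⟨h1, h2⟩ := cluster_off_eq_of_finite (le_superpose (ω, η)) hfin
    refine Set.mem_iUnion.2 ⟨T, h2.trans hT, ?_⟩
    simp only [B, if_pos (hm.trans (hF T))]
    intro e he
    obtain ⟨d, hd, rfl⟩ := Finset.mem_image.1 he
    rw [Finset.mem_filter, mem_boundaryDarts] at hd
    by_contra hη
    have hadj : (openGraph G (superpose (ω, η))).Adj d.fst d.snd := by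
      rw [openGraph_adj_dart]
      simp [superpose, Bool.eq_true_of_not_eq_false hη]
    have hfst : d.fst ∈ cluster G (superpose (ω, η)) v := by rw [hT]; exact hd.1.1
    have := mem_cluster_of_adj hfst hadj
    rw [hT] at this
    exact hd.1.2 this
  calc ν.real _ ≤ ν.real (⋃ T, A T ∩ B T) := measureReal_mono hsub
    _ ≤ (1 - (δ : ℝ)) ^ m * ν.real (⋃ T, A T) := by
      refine real_iUnion_le_of_disjoint ν mA (fun T T' hne ↦ ?_)
        (pow_nonneg (by linarith [δ.2.2]) _) fun T ↦ ?_
      · exact (pairwise_disjoint_cluster_eq (G := G) v hne).preimage f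
      · by_cases hm : m ≤ (F T).card
        · simp only [B, if_pos hm]
          rw [DeterminedBy.real_inter (A := (touching G W)ᶜ) _ _ (mA T) (measurableSet_closed _),
            bondMeasure_real_closed, mul_comm]
          · refine mul_le_mul_of_nonneg_right ?_ measureReal_nonneg
            exact pow_le_pow_of_le_one (by linarith [δ.2.2]) (by linarith [δ.2.1]) hm
          · intro η η' hη hA
            have : f η = f η' := off_congr fun e he ↦ by simp [superpose, hη e he]
            show cluster G (f η') v = T
            rw [← this]
            exact hA
          · rw [compl_compl]
            intro η η' hη hB e he
            rw [← hη e ?_]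
            · exact hB e he
            · obtain ⟨d, hd, rfl⟩ := Finset.mem_image.1 he
              exact mem_touching_right d.adj (Finset.mem_filter.1 hd).2
        · simp only [B, if_neg hm, Set.inter_empty, measureReal_empty]
          exact mul_nonneg (pow_nonneg (by linarith [δ.2.2]) _) measureReal_nonneg
    _ ≤ (1 - (δ : ℝ)) ^ m :=
      mul_le_of_le_one_right (pow_nonneg (by linarith [δ.2.2]) _) measureReal_le_one

theorem measurableSet_escapes (T : Finset V) (P : ℕ → Prop) :
    MeasurableSet {ω : Configuration G | P (escapes G T ω)} :=
  measurable_escapes T (MeasurableSet.of_discrete (s := {n | P n}))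

theorem real_cluster_repulsion (p δ : I) (v : V) (m : ℕ) :
    ((bondMeasure G p).prod (bondMeasure G δ)).real {x | ∃ T : Finset V,
      cluster G (superpose x) v = T ∧ m ≤ escapes G T x.1} ≤ (1 - (δ : ℝ)) ^ m := by
  have hm : MeasurableSet {x : Configuration G × Configuration G | ∃ T : Finset V,
      cluster G (superpose x) v = T ∧ m ≤ escapes G T x.1} := by
    have : {x : Configuration G × Configuration G | ∃ T : Finset V,
        cluster G (superpose x) v = T ∧ m ≤ escapes G T x.1} = ⋃ T : Finset V,
        {x | cluster G (superpose x) v = T} ∩ Prod.fst ⁻¹' {ω | m ≤ escapes G T ω} := by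
      ext x; simp
    rw [this]
    exact MeasurableSet.iUnion fun T ↦ (measurableSet_cluster_superpose_eq v T).inter
      (measurable_fst (measurableSet_escapes T _))
  rw [real_prod_apply hm]
  refine (integral_mono (g := fun _ ↦ (1 - (δ : ℝ)) ^ m) ?_ (integrable_const _) fun ω ↦
    real_cluster_repulsion_section δ ω v m).trans (by simp)
  exact integrable_of_measurable_of_bounded (measurable_real_prodMk_left hm) 1 fun x ↦ by
    rw [abs_of_nonneg measureReal_nonneg]; exact measureReal_le_one

/-- It is unlikely that few boundary edges of a fixed set lead to infinity. -/
theorem real_escapes_le (p : I) (hp : (p : ℝ) < 1) (T : Finset V) (y : ℝ) :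
    (bondMeasure G p).real {ω | (escapes G T ω : ℝ) ≤ y} ≤
      Real.exp (-(Real.log (1 - p) * y)) *
        (bondMeasure G p).real (connectedToInfinity G T)ᶜ := by
  have hp' : 0 < 1 - (p : ℝ) := by linarith
  have hl : Real.log (1 - p) ≤ 0 := Real.log_nonpos (by linarith) (by linarith [p.2.1])
  set A := {ω : Configuration G | (escapes G T ω : ℝ) ≤ y} with hA
  have mA : MeasurableSet A := measurableSet_escapes T fun n ↦ (n : ℝ) ≤ y
  -- Markov's inequality for (1-p)^escapes, whose mean is at most the disconnection probability.
  have h1 : Real.exp (Real.log (1 - p) * y) * (bondMeasure G p).real A ≤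
      ∫ ω, (1 - (p : ℝ)) ^ escapes G T ω ∂(bondMeasure G p) := by
    rw [← integral_indicator_one mA, ← integral_const_mul]
    refine integral_mono (((integrable_const (1 : ℝ)).indicator mA).const_mul _)
      (integrable_pow_escapes p T hp'.le (by linarith [p.2.1])) fun ω ↦ ?_
    by_cases hω : ω ∈ A
    · simp only [Set.indicator_of_mem hω, Pi.one_apply, mul_one]
      rw [← Real.exp_log hp', ← Real.exp_nat_mul, Real.exp_log hp', mul_comm (escapes G T ω : ℝ)]
      exact Real.exp_le_exp.2 (mul_le_mul_of_nonpos_left hω hl)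
    · simp only [Set.indicator_of_notMem hω, mul_zero]
      positivity
  have h2 := h1.trans (integral_pow_escapes_le p T)
  rw [Real.exp_neg, inv_mul_eq_div, le_div_iff₀ (Real.exp_pos _), mul_comm]
  exact h2

/-- Absorbs a prefactor 2: once a x ≥ 2 log 2, half of the exponent pays for it; for smaller x the
constant bound e^(-b) suffices. -/
theorem le_exp_of_le_two_mul_exp {a b : ℝ} (ha : 0 < a) (hb : 0 < b) :
    ∃ c > 0, ∀ x ≥ (1 : ℝ), ∀ A : ℝ, A ≤ 2 * Real.exp (-(a * x)) → A ≤ Real.exp (-b) →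
      A ≤ Real.exp (-(c * x)) := by
  have h2 : 0 < Real.log 2 := Real.log_pos (by norm_num)
  refine ⟨min (a / 2) (b * a / (2 * Real.log 2)), by positivity, fun x hx A h1 h3 ↦ ?_⟩
  rcases le_total (2 * Real.log 2) (a * x) with h | h
  · refine h1.trans ?_
    rw [← Real.exp_log (show (0 : ℝ) < 2 by norm_num), ← Real.exp_add, Real.exp_le_exp,
      Real.exp_log (show (0 : ℝ) < 2 by norm_num)]
    have : min (a / 2) (b * a / (2 * Real.log 2)) * x ≤ a / 2 * x := by
      gcongr; exact min_le_left _ _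
    linarith
  · refine h3.trans (Real.exp_le_exp.2 (neg_le_neg ?_))
    have : min (a / 2) (b * a / (2 * Real.log 2)) * x ≤ b * a / (2 * Real.log 2) * x := by
      gcongr; exact min_le_right _ _
    refine this.trans ?_
    rw [div_mul_eq_mul_div, div_le_iff₀ (by positivity), mul_assoc]
    gcongr

/-- Split according to whether the p-cluster `T` has more than ε|T|^α escapes in the
q-configuration. In both cases the union over `T` costs nothing, since each term is compared with
one of a family of disjoint cluster events. -/
theorem DisconnectionBound.volumeTailBound {p₀ : ℝ} (h0 : 0 ≤ p₀) {d : EReal}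
    (h : DisconnectionBound G p₀ d) : VolumeTailBound G p₀ d := by
  intro p hp d' hd' hd'd
  obtain ⟨q, hq, hqp⟩ := exists_unitInterval_between h0 p hp
  have hqp' : (q : ℝ) < p := hqp
  have hp1 := p.2.2
  obtain ⟨b, hb, hS'⟩ := h p hp d' hd' hd'd
  obtain ⟨c, hc, hS⟩ := h q hq d' hd' hd'd
  obtain ⟨δ, hδ0, hδ⟩ := exists_sprinkling hqp
  have hL : 0 < -Real.log (1 - q) := by
    have : Real.log (1 - q) < 0 := Real.log_neg (by linarith) (by linarith)
    linarith
  set L := -Real.log (1 - q) with hLdef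
  set α := (d' - 1) / d' with hα
  have hα0 : 0 ≤ α := div_nonneg (by linarith) (by linarith)
  -- Chosen so that L ε = c/2: the factor exp(L ε |T|^α) from the Markov bound consumes half of the
  -- exponent in (i).
  set ε := c / (2 * L) with hε
  have hε0 : 0 < ε := by positivity
  obtain ⟨c', hc', hfin⟩ := le_exp_of_le_two_mul_exp (a := min (c / 2) (δ * ε)) (by positivity) hb
  refine ⟨c', hc', fun v n hn ↦ hfin _ (Real.one_le_rpow (by exact_mod_cast hn) hα0) _ ?_ ?_⟩
  swap
  -- The bound independent of n, needed to absorb the factor 2: (i) for a single vertex.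
  · have h1 := hS' {v} (by simp)
    simp only [Finset.card_singleton, Nat.cast_one, Real.one_rpow, mul_one,
      Finset.coe_singleton] at h1
    refine le_trans (measureReal_mono fun ω hω ↦ ?_) h1
    rw [Set.mem_compl_iff, notMem_connectedToInfinity_iff (Set.finite_singleton v),
      clusterOf_singleton]
    exact hω.1
  set x := (n : ℝ) ^ α with hx
  set μ := (bondMeasure G q).prod (bondMeasure G δ)
  have mE : MeasurableSet {ω : Configuration G | (cluster G ω v).Finite ∧
      n ≤ (cluster G ω v).ncard} := by
    have : {ω : Configuration G | (cluster G ω v).Finite ∧ n ≤ (cluster G ω v).ncard} =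
        ⋃ T ∈ {T : Finset V | n ≤ T.card}, {ω | cluster G ω v = T} := by
      ext ω
      simp only [Set.mem_ofPred_eq, Set.mem_iUnion, exists_prop]
      constructor
      · rintro ⟨h1, h2⟩
        exact ⟨h1.toFinset, by rwa [← Set.ncard_eq_toFinset_card _ h1], by simp⟩
      · rintro ⟨T, hT, h⟩
        rw [h, Set.ncard_coe_finset]
        exact ⟨T.finite_toSet, hT⟩
    rw [this]
    exact MeasurableSet.biUnion (Set.to_countable _) fun T _ ↦ measurableSet_cluster_eq v T
  rw [← map_superpose (G := G) hδ, map_measureReal_apply measurable_superpose mE]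
  let A : Finset V → Set (Configuration G × Configuration G) := fun T ↦
    {x | cluster G (superpose x) v = T}
  let B : Finset V → Set (Configuration G) := fun T ↦
    {ω | n ≤ T.card ∧ (escapes G T ω : ℝ) ≤ ε * (T.card : ℝ) ^ α}
  have mB : ∀ T, MeasurableSet (B T) := fun T ↦
    measurableSet_escapes T fun k ↦ n ≤ T.card ∧ (k : ℝ) ≤ ε * (T.card : ℝ) ^ α
  have hB : ∀ T, (bondMeasure G q).real (B T) ≤ Real.exp (-(c / 2 * x)) := by
    intro T
    by_cases hT : n ≤ T.card
    · refine (measureReal_mono fun ω hω ↦ hω.2).trans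
        ((real_escapes_le q (by linarith) T _).trans ?_)
      refine (mul_le_mul_of_nonneg_left (hS T (Finset.card_pos.1 (by omega)))
        (Real.exp_nonneg _)).trans ?_
      rw [← Real.exp_add, Real.exp_le_exp]
      have h1 : Real.log (1 - q) = -L := by rw [hLdef, neg_neg]
      have h2 : L * ε = c / 2 := by rw [hε]; field_simp
      have h3 : x ≤ (T.card : ℝ) ^ α := by
        rw [hx]; gcongr
      rw [h1, ← mul_assoc, neg_mul, h2]
      nlinarith
    · have : B T = ∅ := Set.eq_empty_of_forall_notMem fun ω hω ↦ hT hω.1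
      rw [this, measureReal_empty]
      positivity
  have hsub : superpose ⁻¹' {ω : Configuration G | (cluster G ω v).Finite ∧
      n ≤ (cluster G ω v).ncard} ⊆ (⋃ T, A T ∩ Prod.fst ⁻¹' B T) ∪
        {y | ∃ T : Finset V, cluster G (superpose y) v = T ∧ ⌈ε * x⌉₊ ≤ escapes G T y.1} := by
    rintro y ⟨h1, h2⟩
    rw [Set.ncard_eq_toFinset_card _ h1] at h2
    by_cases h3 : (escapes G h1.toFinset y.1 : ℝ) ≤ ε * (h1.toFinset.card : ℝ) ^ α
    · exact Or.inl (Set.mem_iUnion.2 ⟨h1.toFinset, by simp [A], h2, h3⟩)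
    · refine Or.inr ⟨h1.toFinset, by simp, ?_⟩
      rw [Nat.ceil_le]
      refine le_trans ?_ (not_le.1 h3).le
      rw [hx]
      gcongr
  have h1 : μ.real (⋃ T, A T ∩ Prod.fst ⁻¹' B T) ≤ Real.exp (-(c / 2 * x)) := by
    refine (real_iUnion_le_of_disjoint μ (measurableSet_cluster_superpose_eq v)
      (c := Real.exp (-(c / 2 * x))) ?_ (Real.exp_nonneg _) fun T ↦ ?_).trans
      (mul_le_of_le_one_right (Real.exp_nonneg _) measureReal_le_one)
    · intro T T' hne
      exact (pairwise_disjoint_cluster_eq (G := G) v hne).preimage superpose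
    · rw [real_prod_inter_fst (A := touching G T) _ _ (measurableSet_cluster_superpose_eq v T)
        (mB T), mul_comm]
      · exact mul_le_mul_of_nonneg_right (hB T) measureReal_nonneg
      · intro η ω ω' hω hT
        have h4 := determinedBy_clusterOf_eq (G := G) {v} (T : Set V)
        simp only [clusterOf_singleton] at h4
        exact h4 (fun e he ↦ by simp [superpose, hω e he]) hT
      · intro ω ω' hω hB'
        have h4 : escapes G T ω = escapes G T ω' := by
          unfold escapes occurring
          congr 2
          ext d
          exact (determinedBy_connectedToInfinityOff _ _).iff hω
        exact ⟨hB'.1, h4 ▸ hB'.2⟩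
  have h2 : μ.real {y | ∃ T : Finset V, cluster G (superpose y) v = T ∧
      ⌈ε * x⌉₊ ≤ escapes G T y.1} ≤ Real.exp (-(δ * ε * x)) := by
    refine (real_cluster_repulsion q δ v _).trans ?_
    calc (1 - (δ : ℝ)) ^ ⌈ε * x⌉₊ ≤ Real.exp (-δ) ^ ⌈ε * x⌉₊ := by
          gcongr
          · linarith [δ.2.2]
          · linarith [Real.add_one_le_exp (-(δ : ℝ))]
      _ = Real.exp (-(δ * ⌈ε * x⌉₊)) := by rw [← Real.exp_nat_mul]; ring_nf
      _ ≤ _ := by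
        rw [Real.exp_le_exp, neg_le_neg_iff, mul_assoc]
        gcongr
        exact Nat.le_ceil _
  have hx0 : 0 ≤ x := by positivity
  have h3 : Real.exp (-(c / 2 * x)) ≤ Real.exp (-(min (c / 2) (δ * ε) * x)) := by
    gcongr; exact min_le_left _ _
  have h4 : Real.exp (-(δ * ε * x)) ≤ Real.exp (-(min (c / 2) (δ * ε) * x)) := by
    gcongr; exact min_le_right _ _
  calc _ ≤ _ := measureReal_mono hsub
    _ ≤ _ := measureReal_union_le _ _
    _ ≤ _ := by linarith

end

/-! ### Isoperimetry of clusters anchored at a vertex -/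

/-- The component of `v` is infinite and satisfies an isoperimetric inequality with exponent `α` and
constant `c` for finite connected sets that contain `v`, where sets are measured by their number of
vertices. -/
def AnchoredAt (H : SimpleGraph V) (α c : ℝ) (v : V) : Prop :=
  {x | H.Reachable v x}.Infinite ∧ ∀ W : Finset V, v ∈ W → (H.induce (W : Set V)).Connected →
    c * (W.card : ℝ) ^ α ≤ ((edgeBoundary H (W : Set V)).ncard : ℝ)

theorem AnchoredAt.mono {H : SimpleGraph V} {α c c' : ℝ} {v : V} (h : AnchoredAt H α c v)
    (hc : c' ≤ c) : AnchoredAt H α c' v :=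
  ⟨h.1, fun W hv hW ↦ le_trans (by gcongr) (h.2 W hv hW)⟩

/-- An anchored inequality is preserved by isomorphisms. -/
theorem AnchoredAt.of_iso {V' : Type*} {H : SimpleGraph V} {H' : SimpleGraph V'} (f : H ≃g H')
    {α c : ℝ} {v : V} (h : AnchoredAt H' α c (f v)) : AnchoredAt H α c v := by
  refine ⟨?_, fun W hv hW ↦ ?_⟩
  · have : {x | H'.Reachable (f v) x} ⊆ f '' {x | H.Reachable v x} := by
      intro y hy
      refine ⟨f.symm y, ?_, by simp⟩
      have h2 : H'.Reachable (f v) y := hy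
      show H.Reachable v (f.symm y)
      rw [← f.reachable_iff]
      simpa using h2
    exact (h.1.mono this).of_image f
  · let W' := W.map f.toEquiv.toEmbedding
    have hmem : ∀ x, f x ∈ W' ↔ x ∈ W := fun x ↦
      Finset.mem_map' f.toEquiv.toEmbedding
    have hW' : (H'.induce (W' : Set V')).Connected := by
      refine hW.map (f := ⟨fun x ↦ ⟨f x.1, (hmem x.1).2 x.2⟩, fun {a b} hab ↦ ?_⟩) ?_
      · exact f.map_adj_iff.2 hab
      · rintro ⟨y, hy⟩
        obtain ⟨x, hx, rfl⟩ := Finset.mem_map.1 hy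
        exact ⟨⟨x, hx⟩, rfl⟩
    have h1 := h.2 W' ((hmem v).2 hv) hW'
    have h2 : edgeBoundary H' (W' : Set V') = Sym2.map f '' edgeBoundary H (W : Set V) := by
      ext e
      constructor
      · rintro ⟨a, ha, b, hb, hab, rfl⟩
        refine ⟨s(f.symm a, f.symm b), ⟨f.symm a, ?_, f.symm b, ?_, f.symm.map_adj_iff.2 hab, rfl⟩,
          by simp⟩
        · rw [Finset.mem_coe, ← hmem]; simpa using ha
        · rw [Finset.mem_coe, ← hmem]; simpa using hb
      · rintro ⟨_, ⟨a, ha, b, hb, hab, rfl⟩, rfl⟩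
        exact ⟨f a, (hmem a).2 ha, f b, fun h ↦ hb ((hmem b).1 h), f.map_adj_iff.2 hab, by simp⟩
    rw [h2, Set.ncard_image_of_injective _ (Sym2.map.injective f.injective)] at h1
    simpa [W'] using h1

/-- The component of a vertex induces a connected subgraph, in any larger graph. -/
theorem connected_induce_of_reachable {K H : SimpleGraph V} (hKH : K ≤ H) (v : V) {W : Set V}
    (hW : ∀ x, x ∈ W ↔ K.Reachable v x) : (H.induce W).Connected := by
  have h : W = (K.connectedComponentMk v).supp := by
    ext x
    rw [hW, SimpleGraph.ConnectedComponent.mem_supp_iff, SimpleGraph.ConnectedComponent.eq]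
    exact SimpleGraph.reachable_comm
  subst h
  exact (K.connectedComponentMk v).connected_toSimpleGraph.mono fun _ _ hab ↦ hKH hab

theorem determinedBy_connected_induce (W : Set V) :
    DeterminedBy {ω : Configuration G | ((openGraph G ω).induce W).Connected}
      {e | ∀ x ∈ e.1, x ∈ W} := by
  intro ω ω' h hω
  have : (openGraph G ω).induce W = (openGraph G ω').induce W := by
    ext a b
    simp only [SimpleGraph.comap_adj, openGraph_adj]
    refine exists_congr fun hab ↦ ?_
    rw [h _ fun x hx ↦ ?_]
    rcases Sym2.mem_iff.1 hx with rfl | rfl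
    · exact a.2
    · exact b.2
  show ((openGraph G ω').induce W).Connected
  rw [← this]
  exact hω

theorem inner_subset_touching (W : Set V) :
    {e : G.edgeSet | ∀ x ∈ e.1, x ∈ W} ⊆ touching G W := by
  rintro ⟨e, he⟩ h
  induction e using Sym2.ind with
  | _ a b => exact ⟨a, Sym2.mem_mk_left a b, h a (Sym2.mem_mk_left a b)⟩

section

variable [G.LocallyFinite]

open Classical in
/-- The boundary edges of a finite set that are open. -/
noncomputable def openBoundary (G : SimpleGraph V) [G.LocallyFinite] (ω : Configuration G)
    (W : Finset V) : Finset G.Dart :=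
  (boundaryDarts G W).filter fun d ↦ ω (dartEdge d) = true

theorem mem_openBoundary {ω : Configuration G} {W : Finset V} {d : G.Dart} :
    d ∈ openBoundary G ω W ↔ (d.fst ∈ W ∧ d.snd ∉ W) ∧ ω (dartEdge d) = true := by
  simp [openBoundary, mem_boundaryDarts]

theorem ncard_edgeBoundary (ω : Configuration G) (W : Finset V) :
    (edgeBoundary (openGraph G ω) (W : Set V)).ncard = (openBoundary G ω W).card := by
  have h : edgeBoundary (openGraph G ω) (W : Set V) =
      (fun d : G.Dart ↦ d.edge) '' (openBoundary G ω W : Set G.Dart) := by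
    ext e
    constructor
    · rintro ⟨a, ha, b, hb, hab, rfl⟩
      exact ⟨⟨(a, b), hab.1⟩, mem_openBoundary.2 ⟨⟨ha, hb⟩, hab.2⟩, rfl⟩
    · rintro ⟨d, hd, rfl⟩
      obtain ⟨⟨h1, h2⟩, h3⟩ := mem_openBoundary.1 hd
      exact ⟨d.fst, h1, d.snd, h2, (openGraph_adj_dart d).2 h3, rfl⟩
  rw [h, Set.InjOn.ncard_image, Set.ncard_coe_finset]
  intro d hd d' hd' hdd'
  have h1 := (mem_openBoundary.1 hd).1
  have h2 := (mem_openBoundary.1 hd').1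
  exact dartEdge_injOn W (mem_boundaryDarts.2 h1) (mem_boundaryDarts.2 h2) (Subtype.ext hdd')

theorem openBoundary_nonempty {ω : Configuration G} {W : Finset V} {v : V} (hv : v ∈ W)
    (h : (cluster G ω v).Infinite) : (openBoundary G ω W).Nonempty := by
  by_contra hne
  rw [Finset.not_nonempty_iff_eq_empty] at hne
  refine h (W.finite_toSet.subset fun x hx ↦ ?_)
  refine mem_of_reachable (T := (W : Set V)) (fun a ha b hab ↦ ?_) hv hx
  by_contra hb
  have : (⟨(a, b), hab.1⟩ : G.Dart) ∈ openBoundary G ω W := mem_openBoundary.2 ⟨⟨ha, hb⟩, hab.2⟩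
  simp [hne] at this

theorem determinedBy_openBoundary (W : Finset V) (P : Finset G.Dart → Prop) :
    DeterminedBy {ω : Configuration G | P (openBoundary G ω W)}
      (dartEdge '' (boundaryDarts G W : Set G.Dart)) := by
  intro ω ω' h hω
  have : openBoundary G ω W = openBoundary G ω' W := by
    ext d
    simp only [mem_openBoundary]
    refine and_congr_right fun hd ↦ ?_
    rw [h _ ⟨d, mem_boundaryDarts.2 hd, rfl⟩]
  show P (openBoundary G ω' W)
  rw [← this]
  exact hω

theorem measurableSet_connected_induce (W : Finset V) :
    MeasurableSet {ω : Configuration G | ((openGraph G ω).induce (W : Set V)).Connected} :=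
  (determinedBy_connected_induce _).measurableSet
    ((finite_touching W.finite_toSet).subset (inner_subset_touching _))

theorem measurableSet_openBoundary (W : Finset V) (P : Finset G.Dart → Prop) :
    MeasurableSet {ω : Configuration G | P (openBoundary G ω W)} :=
  (determinedBy_openBoundary W P).measurableSet ((boundaryDarts G W).finite_toSet.image _)

theorem measurableSet_anchoredAt [Countable V] (α c : ℝ) (v : V) :
    MeasurableSet {ω : Configuration G | AnchoredAt (openGraph G ω) α c v} := by
  have : {ω : Configuration G | AnchoredAt (openGraph G ω) α c v} =
      {ω | (cluster G ω v).Infinite} ∩ ⋂ W ∈ {W : Finset V | v ∈ W},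
        ({ω | ((openGraph G ω).induce (W : Set V)).Connected}ᶜ ∪
          {ω | c * (W.card : ℝ) ^ α ≤ ((openBoundary G ω W).card : ℝ)}) := by
    ext ω
    simp only [AnchoredAt, ncard_edgeBoundary, imp_iff_not_or (a := SimpleGraph.Connected _)]
    simp [cluster]
  rw [this]
  exact (measurableSet_cluster_infinite v).inter (MeasurableSet.biInter (Set.to_countable _)
    fun W _ ↦ (measurableSet_connected_induce W).compl.union
      (measurableSet_openBoundary W fun s ↦ c * (W.card : ℝ) ^ α ≤ (s.card : ℝ)))

/-! ### From anchored isoperimetry to the boundary bound -/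

open Classical in
/-- If a finite set contains many vertices whose cluster satisfies an anchored isoperimetric
inequality, then many of its boundary edges lead to infinity. -/
theorem card_mul_le_escapes (ω : Configuration G) (S : Finset V) {α c : ℝ} (hα0 : 0 ≤ α)
    (hα1 : α ≤ 1) (hc : 0 ≤ c) :
    ((S.filter fun w ↦ AnchoredAt (openGraph G ω) α c w).card : ℝ) * (c * (S.card : ℝ) ^ (α - 1)) ≤
      escapes G S ω := by
  -- `X` is `S` together with every vertex whose cluster off `S` is finite, that is, `S` with its
  -- finite holes filled. `C w` below is the cluster of `w` inside `X`.
  set X : Set V := {x | (cluster G (off S ω) x).Finite} with hX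
  have hSX : ∀ x ∈ S, x ∈ X := fun x hx ↦ by
    show (cluster G (off S ω) x).Finite
    rw [cluster_off_of_mem (S := (S : Set V)) hx]
    exact Set.finite_singleton x
  let C : V → Set V := fun w ↦ cluster G (off Xᶜ ω) w
  have hCX : ∀ w ∈ X, ∀ x ∈ C w, x ∈ X := fun w hw x hx ↦
    not_not.1 (notMem_of_mem_cluster_off (S := Xᶜ) (not_not.2 hw) hx)
  have hCfin : ∀ w ∈ S, (C w).Finite := by
    intro w hw
    refine ((S.finite_toSet).union (((boundaryDarts G S).filter (·.snd ∈ X)).finite_toSet.biUnion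
        (t := fun d ↦ cluster G (off S ω) d.snd) ?_)).subset ?_
    · exact fun d hd ↦ (Finset.mem_filter.1 hd).2
    · intro x hx
      refine mem_of_reachable ?_ (Set.mem_union_left _ hw) hx
      intro x hx y hxy
      rw [openGraph_off_adj] at hxy
      obtain ⟨hxy, hxX, hyX⟩ := hxy
      by_cases hy : y ∈ S
      · exact Or.inl hy
      right
      simp only [Set.mem_iUnion]
      by_cases hxS : x ∈ S
      · exact ⟨⟨(x, y), hxy.1⟩, Finset.mem_coe.2 (Finset.mem_filter.2
          ⟨mem_boundaryDarts.2 ⟨hxS, hy⟩, not_not.1 hyX⟩), mem_cluster_self _ _⟩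
      · rcases hx with hx | hx
        · exact absurd hx hxS
        simp only [Set.mem_iUnion] at hx
        obtain ⟨d, hd, hx⟩ := hx
        exact ⟨d, hd, mem_cluster_of_adj hx (openGraph_off_adj.2 ⟨hxy, hxS, hy⟩)⟩
  set D := (boundaryDarts G S).filter fun d ↦ ω ∈ connectedToInfinityOff G S d.snd with hD
  -- An open edge leaving `C w` must leave `X`. Its inner end lies in `S`, for otherwise both ends
  -- would share a finite cluster off `S`; hence it is an escape of `S`.
  have hbd : ∀ w ∈ S, ∀ W : Finset V, (W : Set V) = C w →
      (openBoundary G ω W).card ≤ (D.filter (·.fst ∈ C w)).card := by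
    intro w hw W hW
    refine Finset.card_le_card fun d hd ↦ ?_
    obtain ⟨⟨h1, h2⟩, h3⟩ := mem_openBoundary.1 hd
    rw [← Finset.mem_coe, hW] at h1 h2
    have hadj := (openGraph_adj_dart d).2 h3
    have h1X : d.fst ∈ X := hCX w (hSX w hw) _ h1
    have h2X : d.snd ∉ X := fun h ↦ h2 (mem_cluster_of_adj h1
      (openGraph_off_adj.2 ⟨hadj, not_not.2 h1X, not_not.2 h⟩))
    have h2S : d.snd ∉ S := fun h ↦ h2X (hSX _ h)
    have h1S : d.fst ∈ S := by
      by_contra h1S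
      refine h2X ?_
      show (cluster G (off S ω) d.snd).Finite
      rw [cluster_eq_of_mem (v := d.fst)]
      · exact h1X
      · exact mem_cluster_of_adj (mem_cluster_self _ _) (openGraph_off_adj.2 ⟨hadj, h1S, h2S⟩)
    rw [Finset.mem_filter, hD, Finset.mem_filter, mem_boundaryDarts, mem_connectedToInfinityOff]
    exact ⟨⟨⟨h1S, h2S⟩, h2X⟩, h1⟩
  -- Weighting by 1/y(w), where y(w) = |S ∩ C w|, makes each piece `C w` count once although it is
  -- anchored at each of its vertices in `S`.
  let y : V → ℕ := fun w ↦ (S.filter (· ∈ C w)).card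
  have hy0 : ∀ w ∈ S, 0 < y w := fun w hw ↦
    Finset.card_pos.2 ⟨w, Finset.mem_filter.2 ⟨hw, mem_cluster_self _ _⟩⟩
  have hgood : ∀ w ∈ S.filter (fun w ↦ AnchoredAt (openGraph G ω) α c w),
      c * (S.card : ℝ) ^ (α - 1) ≤ (D.filter (·.fst ∈ C w)).card / (y w : ℝ) := by
    intro w hw
    obtain ⟨hw, hgw⟩ := Finset.mem_filter.1 hw
    have hy : (0 : ℝ) < y w := by exact_mod_cast hy0 w hw
    set W := (hCfin w hw).toFinset with hWdef
    have hW : (W : Set V) = C w := by simp [hWdef]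
    have hconn : ((openGraph G ω).induce (W : Set V)).Connected :=
      connected_induce_of_reachable (openGraph_mono (off_le Xᶜ ω)) w fun x ↦ by rw [hW]; rfl
    have h1 := hgw.2 W (by rw [← Finset.mem_coe, hW]; exact mem_cluster_self _ _) hconn
    rw [ncard_edgeBoundary] at h1
    have h2 : (y w : ℝ) ≤ W.card := by
      refine Nat.cast_le.2 (Finset.card_le_card fun x hx ↦ ?_)
      rw [← Finset.mem_coe, hW]
      exact (Finset.mem_filter.1 hx).2
    rw [le_div_iff₀ hy]
    -- Since α ≤ 1, replacing |S| by the smaller y(w) increases the power with exponent α - 1.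
    calc c * (S.card : ℝ) ^ (α - 1) * y w ≤ c * (y w : ℝ) ^ (α - 1) * y w := by
          refine mul_le_mul_of_nonneg_right (mul_le_mul_of_nonneg_left ?_ hc) hy.le
          refine Real.rpow_le_rpow_of_nonpos hy ?_ (by linarith)
          exact_mod_cast Finset.card_filter_le _ _
      _ = c * (y w : ℝ) ^ α := by
        rw [mul_assoc, ← Real.rpow_add_one hy.ne', sub_add_cancel]
      _ ≤ c * (W.card : ℝ) ^ α := by gcongr
      _ ≤ (openBoundary G ω W).card := h1
      _ ≤ _ := by exact_mod_cast hbd w hw W hW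
  calc _ ≤ ∑ w ∈ S.filter (fun w ↦ AnchoredAt (openGraph G ω) α c w),
        ((D.filter (·.fst ∈ C w)).card : ℝ) / (y w : ℝ) := by
        rw [← nsmul_eq_mul]
        exact Finset.card_nsmul_le_sum _ _ _ hgood
    _ ≤ ∑ w ∈ S, ((D.filter (·.fst ∈ C w)).card : ℝ) / (y w : ℝ) :=
      Finset.sum_le_sum_of_subset_of_nonneg (Finset.filter_subset _ _)
        fun _ _ _ ↦ by positivity
    _ = ∑ w ∈ S, ∑ d ∈ D, if d.fst ∈ C w then (1 : ℝ) / y w else 0 := by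
      refine Finset.sum_congr rfl fun w _ ↦ ?_
      rw [← Finset.sum_filter, Finset.sum_const, nsmul_eq_mul, mul_one_div]
    _ = ∑ d ∈ D, ∑ w ∈ S, if d.fst ∈ C w then (1 : ℝ) / y w else 0 := Finset.sum_comm
    _ ≤ ∑ d ∈ D, 1 := by
      refine Finset.sum_le_sum fun d hd ↦ ?_
      have hdS : d.fst ∈ S := (mem_boundaryDarts.1 (Finset.mem_filter.1 hd).1).1
      have h1 : ∀ w, d.fst ∈ C w ↔ w ∈ C d.fst := fun w ↦
        ⟨fun h ↦ SimpleGraph.Reachable.symm h, fun h ↦ SimpleGraph.Reachable.symm h⟩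
      have h2 : ∀ w, d.fst ∈ C w → y w = y d.fst := fun w h ↦ by
        simp only [y, C, cluster_eq_of_mem h]
      -- Exactly y(d.fst) vertices of `S` lie in the piece of `d.fst`, all with the same weight, so
      -- each escape is charged exactly 1.
      calc _ = ∑ w ∈ S, if w ∈ C d.fst then (1 : ℝ) / y d.fst else 0 := by
            refine Finset.sum_congr rfl fun w _ ↦ ?_
            by_cases h : d.fst ∈ C w
            · rw [if_pos h, if_pos ((h1 w).1 h), h2 w h]
            · rw [if_neg h, if_neg fun h' ↦ h ((h1 w).2 h')]
        _ = 1 := by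
          rw [← Finset.sum_filter, Finset.sum_const, nsmul_eq_mul, mul_one_div_cancel]
          exact_mod_cast (hy0 _ hdS).ne'
        _ ≤ 1 := le_rfl
    _ = escapes G S ω := by
      rw [Finset.sum_const, nsmul_one, escapes, occurring]

/-- The expected number of good vertices of `S` is at least θ|S|, and |S| · |S|^(α-1) = |S|^α. -/
theorem le_meanEscapes_of_anchoredAt [Countable V] {p : I} {α c θ : ℝ} (hα0 : 0 ≤ α) (hα1 : α ≤ 1)
    (hc : 0 ≤ c)
    (h : ∀ w, θ ≤ (bondMeasure G p).real {ω | AnchoredAt (openGraph G ω) α c w}) {S : Finset V}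
    (hS : S.Nonempty) : θ * c * (S.card : ℝ) ^ α ≤ meanEscapes G p S := by
  classical
  let A : V → Set (Configuration G) := fun w ↦ {ω | AnchoredAt (openGraph G ω) α c w}
  have mA : ∀ w, MeasurableSet (A w) := fun w ↦ measurableSet_anchoredAt α c w
  have h1 : ∫ ω, (occurring S A ω : ℝ) * (c * (S.card : ℝ) ^ (α - 1)) ∂(bondMeasure G p) ≤
      ∫ ω, (escapes G S ω : ℝ) ∂(bondMeasure G p) := by
    refine integral_mono ((integrable_occurring _ S mA).mul_const _) (integrable_escapes p S)
      fun ω ↦ ?_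
    have h2 : occurring S A ω = (S.filter fun w ↦ AnchoredAt (openGraph G ω) α c w).card := by
      unfold occurring
      congr
    simp only [h2]
    exact card_mul_le_escapes ω S hα0 hα1 hc
  rw [integral_mul_const, integral_occurring _ S mA, integral_escapes] at h1
  refine le_trans ?_ h1
  have h2 : (S.card : ℝ) * θ ≤ ∑ w ∈ S, (bondMeasure G p).real (A w) := by
    rw [← nsmul_eq_mul]
    exact Finset.card_nsmul_le_sum _ _ _ fun w _ ↦ h w
  have hS0 : (0 : ℝ) < S.card := by exact_mod_cast hS.card_pos
  calc θ * c * (S.card : ℝ) ^ α = S.card * θ * (c * (S.card : ℝ) ^ (α - 1)) := by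
        rw [Real.rpow_sub_one hS0.ne']
        field_simp
    _ ≤ _ := by gcongr

end

/-! ### From the volume tail to anchored isoperimetry -/

theorem real_iUnion_le_tsum {α : Type*} [MeasurableSpace α] (μ : Measure α) [IsFiniteMeasure μ]
    {A : ℕ → Set α} {u : ℕ → ℝ} (hu : Summable u) (h : ∀ n, μ.real (A n) ≤ u n) :
    μ.real (⋃ n, A n) ≤ ∑' n, u n := by
  have h0 : ∀ n, 0 ≤ u n := fun n ↦ measureReal_nonneg.trans (h n)
  rw [measureReal_def, ← ENNReal.toReal_ofReal (tsum_nonneg h0)]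
  refine ENNReal.toReal_mono ENNReal.ofReal_ne_top ?_
  rw [ENNReal.ofReal_tsum_of_nonneg h0 hu]
  refine (measure_iUnion_le A).trans (ENNReal.tsum_le_tsum fun n ↦ ?_)
  rw [← ofReal_measureReal (μ := μ) (s := A n)]
  exact ENNReal.ofReal_le_ofReal (h n)

section

variable [G.LocallyFinite]

theorem card_boundaryDarts_le {D : ℕ} (hD : ∀ v, G.degree v ≤ D) (W : Finset V) :
    (boundaryDarts G W).card ≤ D * W.card := by
  classical
  have h := sum_boundaryDarts (G := G) W fun _ ↦ 1
  simp only [Finset.sum_const, nsmul_eq_mul, mul_one] at h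
  have h2 : ((boundaryDarts G W).card : ℝ) ≤ ∑ a ∈ W, (D : ℝ) := by
    rw [← h]
    refine Finset.sum_le_sum fun a _ ↦ ?_
    refine Nat.cast_le.2 (le_trans (Finset.card_le_card Finset.sdiff_subset) ?_)
    rw [SimpleGraph.card_neighborFinset_eq_degree]
    exact hD a
  rw [Finset.sum_const, nsmul_eq_mul] at h2
  have h3 : ((boundaryDarts G W).card : ℝ) ≤ ((D * W.card : ℕ) : ℝ) := by
    push_cast; linarith
  exact_mod_cast h3

/-- Union bound over the t-subsets of the boundary that contain all open edges:
binom(m,t)(1-p)^(m-t). Using m + 1 in place of m keeps the base at least 1, which covers m ≤ t. -/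
theorem real_card_openBoundary_le (p : I) (hp : (p : ℝ) < 1) (W : Finset V) (t : ℕ) :
    (bondMeasure G p).real {ω | (openBoundary G ω W).card ≤ t} ≤
      (((boundaryDarts G W).card + 1) / (1 - (p : ℝ))) ^ t *
        (1 - (p : ℝ)) ^ (boundaryDarts G W).card := by
  classical
  have hp0 : 0 < 1 - (p : ℝ) := by linarith
  have hp1 : 1 - (p : ℝ) ≤ 1 := by linarith [p.2.1]
  set m := (boundaryDarts G W).card with hm
  rcases le_total m t with hmt | hmt
  · refine measureReal_le_one.trans ?_
    calc (1 : ℝ) = (1 / (1 - (p : ℝ))) ^ t * (1 - (p : ℝ)) ^ t := by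
          rw [← mul_pow, one_div_mul_cancel hp0.ne', one_pow]
      _ ≤ ((m + 1) / (1 - (p : ℝ))) ^ t * (1 - (p : ℝ)) ^ m := by
        refine mul_le_mul ?_ (pow_le_pow_of_le_one hp0.le hp1 hmt) (by positivity) (by positivity)
        gcongr
        linarith [(Nat.cast_nonneg m : (0 : ℝ) ≤ m)]
  · let B : Finset G.Dart → Set (Configuration G) := fun J ↦
      {ω | ∀ e ∈ (boundaryDarts G W \ J).image dartEdge, ω e = false}
    have hsub : {ω | (openBoundary G ω W).card ≤ t} ⊆
        ⋃ J ∈ (boundaryDarts G W).powersetCard t, B J := by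
      intro ω hω
      obtain ⟨J, hJ1, hJ2, hJ3⟩ := Finset.exists_subsuperset_card_eq
        (show openBoundary G ω W ⊆ boundaryDarts G W from Finset.filter_subset _ _) hω hmt
      simp only [Set.mem_iUnion]
      refine ⟨J, Finset.mem_powersetCard.2 ⟨hJ2, hJ3⟩, fun e he ↦ ?_⟩
      obtain ⟨d, hd, rfl⟩ := Finset.mem_image.1 he
      rw [Finset.mem_sdiff] at hd
      by_contra h
      exact hd.2 (hJ1 (mem_openBoundary.2 ⟨mem_boundaryDarts.1 hd.1,
        Bool.eq_true_of_not_eq_false h⟩))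
    have hB : ∀ J ∈ (boundaryDarts G W).powersetCard t,
        (bondMeasure G p).real (B J) = (1 - (p : ℝ)) ^ (m - t) := by
      intro J hJ
      rw [Finset.mem_powersetCard] at hJ
      rw [bondMeasure_real_closed, Finset.card_image_of_injOn ((dartEdge_injOn W).mono (by simp)),
        Finset.card_sdiff_of_subset hJ.1, hJ.2]
    refine (measureReal_mono hsub (measure_ne_top _ _)).trans ((measureReal_biUnion_finset_le _ _).trans ?_)
    rw [Finset.sum_congr rfl hB, Finset.sum_const, Finset.card_powersetCard, nsmul_eq_mul]
    have h1 : ((m.choose t : ℕ) : ℝ) ≤ (m + 1 : ℝ) ^ t := by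
      calc ((m.choose t : ℕ) : ℝ) ≤ (m : ℝ) ^ t := by exact_mod_cast Nat.choose_le_pow m t
        _ ≤ (m + 1 : ℝ) ^ t := by gcongr; linarith
    calc (m.choose t : ℝ) * (1 - (p : ℝ)) ^ (m - t)
        ≤ (m + 1 : ℝ) ^ t * (1 - (p : ℝ)) ^ (m - t) := by gcongr
      _ = _ := by
        rw [div_pow, div_mul_eq_mul_div, eq_div_iff (by positivity), mul_assoc, ← pow_add,
          Nat.sub_add_cancel hmt]

/-- A connected set with few open boundary edges becomes a cluster after closing these edges. -/
theorem real_connected_inter_le (p : I) (hp : (p : ℝ) < 1) (W : Finset V) {v : V} (hv : v ∈ W)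
    (t : ℕ) :
    (bondMeasure G p).real ({ω | ((openGraph G ω).induce (W : Set V)).Connected} ∩
      {ω | (openBoundary G ω W).card ≤ t}) ≤
      (((boundaryDarts G W).card + 1) / (1 - (p : ℝ))) ^ t *
        (bondMeasure G p).real {ω | cluster G ω v = W} := by
  classical
  have hp0 : 0 < 1 - (p : ℝ) := by linarith
  have hsub : (dartEdge '' (boundaryDarts G W : Set G.Dart)) ⊆
      {e : G.edgeSet | ∀ x ∈ e.1, x ∈ (W : Set V)}ᶜ := by
    rintro _ ⟨d, hd, rfl⟩ h
    exact (mem_boundaryDarts.1 hd).2 (h d.snd (Sym2.mem_mk_right d.fst d.snd))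
  have hconn := determinedBy_connected_induce (G := G) (W : Set V)
  have mconn := measurableSet_connected_induce (G := G) W
  rw [hconn.real_inter ((determinedBy_openBoundary W fun s ↦ s.card ≤ t).mono hsub) mconn
    (measurableSet_openBoundary W fun s ↦ s.card ≤ t)]
  -- Closing the whole boundary costs (1-p)^m, the same power that appears in
  -- `real_card_openBoundary_le`; the two cancel, leaving only the factor with exponent t.
  have h1 : (bondMeasure G p).real {ω | ((openGraph G ω).induce (W : Set V)).Connected} *
      (1 - (p : ℝ)) ^ (boundaryDarts G W).card ≤
        (bondMeasure G p).real {ω | cluster G ω v = W} := by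
    rw [← Finset.card_image_of_injOn (dartEdge_injOn W), ← bondMeasure_real_closed,
      ← hconn.real_inter _ mconn (measurableSet_closed _)]
    · refine measureReal_mono ?_
      rintro ω ⟨hω, hcl⟩
      apply Set.Subset.antisymm
      · intro x hx
        refine mem_of_reachable (T := (W : Set V)) (fun a ha b hab ↦ ?_) hv hx
        by_contra hb
        have h2 := hcl (dartEdge ⟨(a, b), hab.1⟩) (Finset.mem_image_of_mem _
          (mem_boundaryDarts.2 ⟨ha, hb⟩))
        rw [(openGraph_adj_dart ⟨(a, b), hab.1⟩).1 hab] at h2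
        exact Bool.false_ne_true h2.symm
      · intro x hx
        have h2 := SimpleGraph.Connected.preconnected hω ⟨v, hv⟩ ⟨x, hx⟩
        exact h2.map (SimpleGraph.Embedding.induce (W : Set V)).toHom
    · intro ω ω' h hω e he
      rw [← h e]
      · exact hω e he
      · obtain ⟨d, hd, rfl⟩ := Finset.mem_image.1 he
        exact hsub ⟨d, hd, rfl⟩
  refine (mul_le_mul_of_nonneg_left (real_card_openBoundary_le p hp W t)
    measureReal_nonneg).trans ?_
  rw [mul_left_comm]
  gcongr

/-- The events that the cluster of `v` equals `W` are disjoint, so summing over `W` needs no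
enumeration of connected sets. Bounded degree enters through |∂W| ≤ D n. -/
theorem real_exists_connected_le [Countable V] {D : ℕ} (hD : ∀ v, G.degree v ≤ D) (p : I)
    (hp : (p : ℝ) < 1) (v : V) (n t : ℕ) :
    (bondMeasure G p).real {ω | ∃ W : Finset V, v ∈ W ∧ W.card = n ∧
      ((openGraph G ω).induce (W : Set V)).Connected ∧ (openBoundary G ω W).card ≤ t} ≤
      ((D * n + 1) / (1 - (p : ℝ))) ^ t *
        (bondMeasure G p).real {ω | (cluster G ω v).Finite ∧ n ≤ (cluster G ω v).ncard} := by
  have hp0 : 0 < 1 - (p : ℝ) := by linarith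
  let A : {W : Finset V // v ∈ W ∧ W.card = n} → Set (Configuration G) := fun W ↦
    {ω | cluster G ω v = (W.1 : Set V)}
  let C : {W : Finset V // v ∈ W ∧ W.card = n} → Set (Configuration G) := fun W ↦
    {ω | ((openGraph G ω).induce (W.1 : Set V)).Connected} ∩
      {ω | (openBoundary G ω W.1).card ≤ t}
  have h := real_iUnion_le_of_disjoint (bondMeasure G p) (A := A) (C := C)
    (c := ((D * n + 1) / (1 - (p : ℝ))) ^ t) (fun W ↦ measurableSet_cluster_eq v W.1)
    (fun W W' hne ↦ pairwise_disjoint_cluster_eq v fun h ↦ hne (Subtype.ext h)) (by positivity)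
    fun W ↦ by
      refine (real_connected_inter_le p hp W.1 W.2.1 t).trans ?_
      refine mul_le_mul_of_nonneg_right ?_ measureReal_nonneg
      gcongr
      have := card_boundaryDarts_le hD W.1
      rw [W.2.2] at this
      exact_mod_cast this
  refine le_trans (measureReal_mono ?_) (h.trans ?_)
  · rintro ω ⟨W, hv, hW, h1, h2⟩
    exact Set.mem_iUnion.2 ⟨⟨W, hv, hW⟩, h1, h2⟩
  · refine mul_le_mul_of_nonneg_left (measureReal_mono ?_) (by positivity)
    intro ω hω
    obtain ⟨W, hW⟩ := Set.mem_iUnion.1 hω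
    have hW' : cluster G ω v = (W.1 : Set V) := hW
    show (cluster G ω v).Finite ∧ n ≤ (cluster G ω v).ncard
    rw [hW', Set.ncard_coe_finset]
    exact ⟨W.1.finite_toSet, W.2.2.ge⟩

end

/-- The prefactor is exp(n^β(log n + O(1))), negligible against exp(c n^α) as β < α. The right side
serves only as a summable bound. -/
theorem eventually_pow_mul_exp_le (D : ℕ) {q c α β : ℝ} (hq0 : 0 < q) (hq1 : q ≤ 1) (hc : 0 < c)
    (hβ : 0 < β) (hβα : β < α) :
    ∀ᶠ n : ℕ in Filter.atTop, ((D * n + 1) / q) ^ ⌊(n : ℝ) ^ β⌋₊ * Real.exp (-(c * (n : ℝ) ^ α)) ≤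
      1 / (n : ℝ) ^ 2 := by
  have hA0 : 0 < ((D : ℝ) + 1) / q := by positivity
  have hA : 1 ≤ ((D : ℝ) + 1) / q := by
    rw [le_div_iff₀ hq0]
    linarith [(Nat.cast_nonneg D : (0 : ℝ) ≤ D)]
  set A := ((D : ℝ) + 1) / q with hAdef
  -- Of the three logarithms, one pays for the base of the power and two for the target 1/n².
  have h1 : (fun x : ℝ ↦ Real.log A + 3 * Real.log x) =o[Filter.atTop]
      fun x : ℝ ↦ x ^ (α - β) := by
    refine Asymptotics.IsLittleO.add ?_
      ((isLittleO_log_rpow_atTop (by linarith)).const_mul_left 3)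
    refine Asymptotics.isLittleO_const_left.2 (Or.inr ?_)
    exact tendsto_norm_atTop_atTop.comp (tendsto_rpow_atTop (by linarith))
  have h2 := tendsto_natCast_atTop_atTop.eventually (h1.def hc)
  filter_upwards [h2, Filter.eventually_ge_atTop 1] with n hn hn1
  have hn1' : (1 : ℝ) ≤ n := by exact_mod_cast hn1
  have hn0 : (0 : ℝ) < n := by linarith
  have hlog : 0 ≤ Real.log n := Real.log_nonneg hn1'
  have hlogA : 0 ≤ Real.log A := Real.log_nonneg hA
  rw [Real.norm_of_nonneg (by positivity), Real.norm_of_nonneg (by positivity)] at hn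
  have hpow : 1 ≤ (n : ℝ) ^ β := Real.one_le_rpow hn1' hβ.le
  have h3 : ((D * n + 1) / q) ^ ⌊(n : ℝ) ^ β⌋₊ ≤
      Real.exp ((n : ℝ) ^ β * (Real.log A + Real.log n)) := by
    calc ((D * n + 1) / q) ^ ⌊(n : ℝ) ^ β⌋₊ ≤ (A * n) ^ ⌊(n : ℝ) ^ β⌋₊ := by
          gcongr
          rw [hAdef, div_mul_eq_mul_div]
          gcongr
          linarith
      _ = Real.exp (⌊(n : ℝ) ^ β⌋₊ * (Real.log A + Real.log n)) := by
        rw [← Real.log_mul hA0.ne' hn0.ne', Real.exp_nat_mul, Real.exp_log (by positivity)]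
      _ ≤ _ := by
        gcongr
        exact Nat.floor_le (by positivity)
  have h4 : 1 / (n : ℝ) ^ 2 = Real.exp (-(2 * Real.log n)) := by
    rw [Real.exp_neg, two_mul, Real.exp_add, Real.exp_log hn0, one_div, pow_two]
  rw [h4]
  refine (mul_le_mul_of_nonneg_right h3 (Real.exp_nonneg _)).trans ?_
  rw [← Real.exp_add, Real.exp_le_exp]
  have h5 : (n : ℝ) ^ α = (n : ℝ) ^ β * (n : ℝ) ^ (α - β) := by
    rw [← Real.rpow_add hn0]; ring_nf
  have h6 := mul_le_mul_of_nonneg_left hn (show 0 ≤ (n : ℝ) ^ β by positivity)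
  have h7 := mul_le_mul_of_nonneg_right hpow hlog
  rw [h5]
  nlinarith

/-- If large finite clusters are unlikely, then clusters satisfy anchored isoperimetric
inequalities with constants that are bounded from below in probability. -/
theorem VolumeTailBound.exists_anchoredAt [Countable V] [G.LocallyFinite]
    (hG : IsBoundedDegree G) {p₀ : ℝ} {d : EReal} (h : VolumeTailBound G p₀ d) {p : I}
    (hp : p₀ < p) (hp1 : (p : ℝ) < 1) {d' : ℝ} (hd' : 1 < d') (hd'd : (d' : EReal) < d) {ε : ℝ}
    (hε : 0 < ε) :
    ∃ c, 0 < c ∧ ∀ v, (bondMeasure G p).real ({ω | (cluster G ω v).Infinite} \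
      {ω | AnchoredAt (openGraph G ω) ((d' - 1) / d') c v}) ≤ ε := by
  obtain ⟨D, hD⟩ := hG
  -- The tail is used at a larger dimension d'' to gain room β < α between the exponents.
  obtain ⟨d'', h1, h2⟩ := EReal.lt_iff_exists_real_btwn.1 hd'd
  have h1' : d' < d'' := by exact_mod_cast h1
  obtain ⟨c, hc, htail⟩ := h p hp d'' (by linarith) h2
  set β := (d' - 1) / d' with hβdef
  set α := (d'' - 1) / d'' with hαdef
  have hβ : 0 < β := div_pos (by linarith) (by linarith)
  have hβα : β < α := by
    rw [hβdef, hαdef, div_lt_div_iff₀ (by linarith) (by linarith)]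
    nlinarith
  have hev := eventually_pow_mul_exp_le D (q := 1 - p) (by linarith) (by linarith [p.2.1]) hc hβ hβα
  have hsum : Summable fun n : ℕ ↦ 1 / (n : ℝ) ^ 2 :=
    Real.summable_one_div_nat_pow.2 (by norm_num)
  have htends := tendsto_sum_nat_add fun n : ℕ ↦ 1 / (n : ℝ) ^ 2
  obtain ⟨N, hN⟩ := Filter.eventually_atTop.1 (hev.and (Filter.eventually_ge_atTop 1))
  obtain ⟨n₀, hn₀N, hn₀⟩ := ((Filter.eventually_ge_atTop N).and
    (htends.eventually_lt_const hε)).exists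
  have hpos : 0 < (n₀ : ℝ) ^ β + 1 := by positivity
  -- This constant serves both regimes: it makes the inequality trivial for |W| < n₀, where one open
  -- boundary edge exists because the cluster is infinite, and it is at most 1 for larger sets.
  refine ⟨((n₀ : ℝ) ^ β + 1)⁻¹, by positivity, fun v ↦ ?_⟩
  let A : ℕ → Set (Configuration G) := fun n ↦ {ω | ∃ W : Finset V, v ∈ W ∧ W.card = n ∧
      ((openGraph G ω).induce (W : Set V)).Connected ∧
      (openBoundary G ω W).card ≤ ⌊(n : ℝ) ^ β⌋₊}
  have hA : ∀ k, (bondMeasure G p).real (A (k + n₀)) ≤ 1 / ((k + n₀ : ℕ) : ℝ) ^ 2 := by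
    intro k
    obtain ⟨h3, h4⟩ := hN (k + n₀) (by omega)
    have hq : 0 < 1 - (p : ℝ) := by linarith
    refine (real_exists_connected_le hD p hp1 v _ _).trans (le_trans ?_ h3)
    exact mul_le_mul_of_nonneg_left (htail v _ h4) (by positivity)
  refine le_trans (measureReal_mono ?_) ((real_iUnion_le_tsum (bondMeasure G p)
    ((summable_nat_add_iff n₀).2 hsum) hA).trans hn₀.le)
  rintro ω ⟨hinf, hbad⟩
  by_contra hω
  refine hbad ⟨hinf, fun W hv hW ↦ ?_⟩
  rw [ncard_edgeBoundary]
  rcases lt_or_ge W.card n₀ with hlt | hge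
  · have h3 : (1 : ℝ) ≤ (openBoundary G ω W).card := by
      exact_mod_cast (openBoundary_nonempty hv hinf).card_pos
    refine le_trans ?_ h3
    rw [inv_mul_le_iff₀ hpos, mul_one]
    have : (W.card : ℝ) ^ β ≤ (n₀ : ℝ) ^ β := by gcongr
    linarith
  · by_contra hlt
    refine hω (Set.mem_iUnion.2 ⟨W.card - n₀, W, hv, by omega, hW, ?_⟩)
    rw [Nat.sub_add_cancel hge]
    refine Nat.le_floor ((not_le.1 hlt).le.trans ?_)
    refine mul_le_of_le_one_left (by positivity) (inv_le_one_of_one_le₀ ?_)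
    linarith [show 0 ≤ (n₀ : ℝ) ^ β by positivity]

/-- The case n = 1 of (iii) bounds the probability of a finite cluster away from 1 uniformly in the
vertex. Losing half of the remainder to bad isoperimetry leaves probability θ for an anchored
inequality at every vertex. -/
theorem VolumeTailBound.boundaryBound [Countable V] [G.LocallyFinite]
    (hG : IsBoundedDegree G) {p₀ : ℝ} (h0 : 0 ≤ p₀) {d : EReal} (h : VolumeTailBound G p₀ d) :
    BoundaryBound G p₀ d := by
  rw [boundaryBound_iff]
  intro p hp d' hd' hd'd
  obtain ⟨q, hq, hqp⟩ := exists_unitInterval_between h0 p hp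
  have hqp' : (q : ℝ) < p := hqp
  have hq1 : (q : ℝ) < 1 := by linarith [p.2.2]
  obtain ⟨a, ha, htail⟩ := h q hq d' hd' hd'd
  have hθ : 0 < (1 - Real.exp (-a)) / 2 := by
    have : Real.exp (-a) < 1 := by rw [Real.exp_lt_one_iff]; linarith
    linarith
  set θ := (1 - Real.exp (-a)) / 2 with hθdef
  obtain ⟨c, hc, hgood⟩ := h.exists_anchoredAt hG hq hq1 hd' hd'd hθ
  have hα0 : 0 ≤ (d' - 1) / d' := div_nonneg (by linarith) (by linarith)
  have hα1 : (d' - 1) / d' ≤ 1 := by rw [div_le_one (by linarith)]; linarith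
  refine ⟨θ * c, by positivity, fun S hS ↦ ?_⟩
  refine (le_meanEscapes_of_anchoredAt (p := q) hα0 hα1 hc.le (fun v ↦ ?_) hS).trans
    (meanEscapes_mono hqp.le S)
  have h1 := htail v 1 le_rfl
  have h2 : (bondMeasure G q).real {ω | (cluster G ω v).Finite} ≤ Real.exp (-a) := by
    simp only [Nat.cast_one, Real.one_rpow, mul_one] at h1
    have hsub : {ω | (cluster G ω v).Finite} ⊆
        {ω : Configuration G | (cluster G ω v).Finite ∧ 1 ≤ (cluster G ω v).ncard} :=
      fun ω hω ↦ ⟨hω, ?_⟩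
    · exact (measureReal_mono hsub).trans h1
    exact (Set.ncard_pos hω).2 ⟨v, mem_cluster_self _ _⟩
  have h3 := probReal_compl_eq_one_sub (μ := bondMeasure G q) (measurableSet_cluster_finite v)
  have h4 : {ω : Configuration G | (cluster G ω v).Finite}ᶜ ⊆
      {ω | AnchoredAt (openGraph G ω) ((d' - 1) / d') c v} ∪
        ({ω | (cluster G ω v).Infinite} \
          {ω | AnchoredAt (openGraph G ω) ((d' - 1) / d') c v}) := by
    intro ω hω
    by_cases h : AnchoredAt (openGraph G ω) ((d' - 1) / d') c v
    · exact Or.inl h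
    · exact Or.inr ⟨hω, h⟩
  have h5 := (measureReal_mono (μ := bondMeasure G q) h4).trans (measureReal_union_le _ _)
  have h6 := hgood v
  linarith

/-! ### Anchored isoperimetry in a component -/

section Component

variable {H : SimpleGraph V} (C : H.ConnectedComponent)

theorem mem_component_of_adj {a b : V} (ha : a ∈ C.supp) (h : H.Adj a b) : b ∈ C.supp :=
  C.mem_supp_of_adj_mem_supp ha h

theorem deg_component (a : C) : deg C.toSimpleGraph a = deg H (a : V) := by
  have h : H.neighborSet (a : V) = Subtype.val '' C.toSimpleGraph.neighborSet a := by
    ext b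
    constructor
    · intro hb
      exact ⟨⟨b, mem_component_of_adj C a.2 hb⟩, hb, rfl⟩
    · rintro ⟨b, hb, rfl⟩
      exact hb
  rw [deg, deg, h, Set.ncard_image_of_injective _ Subtype.val_injective]

theorem ncard_edgeBoundary_component (W : Set C) :
    (edgeBoundary H (Subtype.val '' W)).ncard = (edgeBoundary C.toSimpleGraph W).ncard := by
  have h : edgeBoundary H (Subtype.val '' W) =
      Sym2.map Subtype.val '' edgeBoundary C.toSimpleGraph W := by
    ext e
    constructor
    · rintro ⟨_, ⟨a, ha, rfl⟩, b, hb, hab, rfl⟩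
      let b' : C := ⟨b, mem_component_of_adj C a.2 hab⟩
      exact ⟨s(a, b'), ⟨a, ha, b', fun h ↦ hb ⟨b', h, rfl⟩, hab, rfl⟩, rfl⟩
    · rintro ⟨_, ⟨a, ha, b, hb, hab, rfl⟩, rfl⟩
      refine ⟨a, ⟨a, ha, rfl⟩, b, ?_, hab, rfl⟩
      rintro ⟨b', hb', h⟩
      exact hb (Subtype.val_injective h ▸ hb')
  rw [h, Set.ncard_image_of_injective _ (Sym2.map.injective Subtype.val_injective)]

theorem connected_induce_component_iff (W : Set C) :
    (H.induce (Subtype.val '' W)).Connected ↔ (C.toSimpleGraph.induce W).Connected := by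
  have hmem : ∀ x : (Subtype.val '' W : Set V), ∃ h : (x : V) ∈ C, (⟨x, h⟩ : C) ∈ W := by
    rintro ⟨_, y, hy, rfl⟩
    exact ⟨y.2, hy⟩
  constructor
  · intro h
    refine h.map (f := ⟨fun x ↦ ⟨⟨x.1, (hmem x).1⟩, (hmem x).2⟩, fun hab ↦ hab⟩) ?_
    rintro ⟨x, hx⟩
    exact ⟨⟨x.1, x, hx, rfl⟩, rfl⟩
  · intro h
    refine h.map (f := ⟨fun x ↦ ⟨x.1.1, x.1, x.2, rfl⟩, fun hab ↦ hab⟩) ?_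
    rintro ⟨_, x, hx, rfl⟩
    exact ⟨⟨x, hx⟩, rfl⟩

/-- Bounded degree makes degree sums comparable to cardinalities; D + 1 is used so that the constant
is never divided by zero. -/
theorem AnchoredAt.anchoredIsoperimetricInequality {D : ℕ} (hD : ∀ x, deg H x ≤ D) {d c : ℝ}
    (hd : 1 < d) (hc : 0 < c) {v : V} (hv : v ∈ C.supp) (h : AnchoredAt H ((d - 1) / d) c v) :
    AnchoredIsoperimetricInequality C.toSimpleGraph d := by
  have hα : 0 ≤ (d - 1) / d := div_nonneg (by linarith) (by linarith)
  have hDpos : (0 : ℝ) < (D + 1 : ℝ) ^ ((d - 1) / d) := by positivity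
  refine ⟨⟨v, hv⟩, c / (D + 1 : ℝ) ^ ((d - 1) / d), by positivity, fun W hvW hW ↦ ?_⟩
  have hcoe : ((W.map (Function.Embedding.subtype _) : Finset V) : Set V) =
      Subtype.val '' (W : Set C) := by
    rw [Finset.coe_map]
    rfl
  have h1 := h.2 (W.map (Function.Embedding.subtype _)) (Finset.mem_map.2 ⟨⟨v, hv⟩, hvW, rfl⟩)
  rw [hcoe, connected_induce_component_iff, ncard_edgeBoundary_component, Finset.card_map] at h1
  refine le_trans ?_ (h1 hW)
  have h2 : ((∑ w ∈ W, deg C.toSimpleGraph w : ℕ) : ℝ) ≤ (D + 1) * W.card := by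
    have : ∑ w ∈ W, deg C.toSimpleGraph w ≤ W.card • D :=
      Finset.sum_le_card_nsmul _ _ _ fun w _ ↦ (deg_component C w).trans_le (hD w)
    calc ((∑ w ∈ W, deg C.toSimpleGraph w : ℕ) : ℝ) ≤ ((W.card • D : ℕ) : ℝ) := by
          exact_mod_cast this
      _ ≤ _ := by rw [smul_eq_mul]; push_cast; nlinarith [(Nat.cast_nonneg W.card : (0 : ℝ) ≤ _)]
  calc c / (D + 1 : ℝ) ^ ((d - 1) / d) * ((∑ w ∈ W, deg C.toSimpleGraph w : ℕ) : ℝ) ^ ((d - 1) / d)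
      ≤ c / (D + 1 : ℝ) ^ ((d - 1) / d) * ((D + 1) * W.card : ℝ) ^ ((d - 1) / d) := by gcongr
    _ = c * (W.card : ℝ) ^ ((d - 1) / d) := by
      rw [Real.mul_rpow (by positivity) (by positivity)]
      field_simp

/-- In an infinite component all degrees are at least 1, so the degree sum dominates |W| ≥ 1, and
the exponent may be lowered. -/
theorem AnchoredIsoperimetricInequality.exists_anchoredAt (hfin : ∀ x, (H.neighborSet x).Finite)
    (hC : C.supp.Infinite) {d d' : ℝ} (hd : 1 < d) (hdd' : d ≤ d')
    (h : AnchoredIsoperimetricInequality C.toSimpleGraph d') :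
    ∃ v, ∃ c > 0, AnchoredAt H ((d - 1) / d) c v := by
  obtain ⟨v, c, hc, hW⟩ := h
  refine ⟨v, c, hc, ?_, fun W hv hconn ↦ ?_⟩
  · refine hC.mono fun x hx ↦ ?_
    exact C.reachable_of_mem_supp v.2 hx
  have hsub : (W : Set V) ⊆ C.supp := by
    intro x hx
    have h1 := hconn.preconnected ⟨v, hv⟩ ⟨x, hx⟩
    have h2 : H.Reachable v x := h1.map (SimpleGraph.Embedding.induce (W : Set V)).toHom
    have h3 : (v : V) ∈ C.supp := v.2
    rw [SimpleGraph.ConnectedComponent.mem_supp_iff] at h3 ⊢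
    rw [← h3]
    exact SimpleGraph.ConnectedComponent.eq.2 h2.symm
  classical
  let W' : Finset C := W.subtype (· ∈ C)
  have hcoe : Subtype.val '' (W' : Set C) = (W : Set V) := by
    ext x
    constructor
    · rintro ⟨y, hy, rfl⟩
      exact Finset.mem_subtype.1 hy
    · intro hx
      exact ⟨⟨x, hsub hx⟩, Finset.mem_subtype.2 hx, rfl⟩
  have hcard : W'.card = W.card := by
    rw [← Set.ncard_coe_finset W, ← hcoe, Set.ncard_image_of_injective _ Subtype.val_injective,
      Set.ncard_coe_finset]
  have h1 := hW W' (Finset.mem_subtype.2 hv)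
    ((connected_induce_component_iff C _).1 (by rw [hcoe]; exact hconn))
  rw [← ncard_edgeBoundary_component, hcoe] at h1
  refine le_trans ?_ h1
  have hdeg : ∀ w ∈ W', 1 ≤ deg C.toSimpleGraph w := by
    intro w _
    rw [deg_component, deg, Nat.one_le_iff_ne_zero, ← Nat.pos_iff_ne_zero, Set.ncard_pos (hfin _)]
    obtain ⟨y, hy, hyw⟩ := hC.exists_notMem_finite (Set.finite_singleton (w : V))
    obtain ⟨p⟩ := C.reachable_of_mem_supp w.2 hy
    cases p with
    | nil => exact absurd rfl hyw
    | cons h _ => exact ⟨_, h⟩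
  have h2 : W'.card ≤ ∑ w ∈ W', deg C.toSimpleGraph w := by
    have := Finset.card_nsmul_le_sum W' (fun w ↦ deg C.toSimpleGraph w) 1 hdeg
    simpa using this
  have h3 : 1 ≤ W.card := Finset.card_pos.2 ⟨v, hv⟩
  rw [hcard] at h2
  have hexp : (d - 1) / d ≤ (d' - 1) / d' := by
    rw [div_le_div_iff₀ (by linarith) (by linarith)]
    nlinarith
  have hexp0 : 0 ≤ (d' - 1) / d' := div_nonneg (by linarith) (by linarith)
  refine mul_le_mul_of_nonneg_left ?_ hc.le
  calc (W.card : ℝ) ^ ((d - 1) / d) ≤ (W.card : ℝ) ^ ((d' - 1) / d') :=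
        Real.rpow_le_rpow_of_exponent_le (by exact_mod_cast h3) hexp
    _ ≤ _ := Real.rpow_le_rpow (Nat.cast_nonneg _) (Nat.cast_le.2 h2) hexp0

end Component

/-! ### Automorphisms -/

/-- Bernoulli percolation is invariant under automorphisms. -/
theorem map_comp_automorphism (φ : G ≃g G) (p : I) :
    (bondMeasure G p).map (fun ω e ↦ ω (φ.mapEdgeSet e)) = bondMeasure G p := by
  classical
  have hm : Measurable fun (ω : Configuration G) e ↦ ω (φ.mapEdgeSet e) := by fun_prop
  have : IsProbabilityMeasure
      ((bondMeasure G p).map fun (ω : Configuration G) e ↦ ω (φ.mapEdgeSet e)) :=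
    Measure.isProbabilityMeasure_map hm.aemeasurable
  refine measure_ext_of_closed fun F ↦ ?_
  rw [map_measureReal_apply hm (measurableSet_closed F)]
  have : (fun (ω : Configuration G) e ↦ ω (φ.mapEdgeSet e)) ⁻¹' {ω | ∀ e ∈ F, ω e = false} =
      {ω | ∀ e ∈ F.map φ.mapEdgeSet.toEmbedding, ω e = false} := by
    ext ω
    simp only [Set.mem_preimage, Set.mem_ofPred_eq, Finset.forall_mem_map]
    rfl
  rw [this, bondMeasure_real_closed, bondMeasure_real_closed, Finset.card_map]

/-- An automorphism as an isomorphism between open subgraphs. -/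
def openGraphIso (φ : G ≃g G) (ω : Configuration G) :
    openGraph G (fun e ↦ ω (φ.mapEdgeSet e)) ≃g openGraph G ω where
  toEquiv := φ.toEquiv
  map_rel_iff' :=
    ⟨fun ⟨h, hω⟩ ↦ ⟨φ.map_adj_iff.1 h, hω⟩, fun ⟨h, hω⟩ ↦ ⟨φ.map_adj_iff.2 h, hω⟩⟩

theorem IsTransitive.isBoundedDegree [Nonempty V] [G.LocallyFinite] (h : IsTransitive G) : IsBoundedDegree G := by
  obtain ⟨v⟩ := ‹Nonempty V›
  refine ⟨G.degree v, fun w ↦ ?_⟩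
  obtain ⟨φ, rfl⟩ := h v w
  exact (φ.degree_eq v).le

/-! ### Retention probability one -/

theorem ae_forall_open [Countable V] : ∀ᵐ ω ∂(bondMeasure G 1), ∀ e, ω e = true := by
  rw [ae_all_iff]
  intro e
  have h := bondMeasure_real_closed (G := G) 1 {e}
  simp only [Finset.mem_singleton, forall_eq, Set.Icc.coe_one, sub_self, Finset.card_singleton,
    pow_one] at h
  rw [measureReal_eq_zero_iff] at h
  rw [ae_iff]
  simpa using h

theorem openGraph_eq_of_forall_open {ω : Configuration G} (h : ∀ e, ω e = true) :
    openGraph G ω = G := by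
  ext a b
  exact ⟨fun hab ↦ hab.1, fun hab ↦ ⟨hab, h _⟩⟩

/-- Above the critical probability there is an infinite cluster. -/
theorem ae_exists_infinite [Infinite V] [Countable V] [G.LocallyFinite] (hG : G.Connected) {p : I}
    (hp : criticalProbability G < p) :
    ∀ᵐ ω ∂(bondMeasure G p), ∃ v : V, (cluster G ω v).Infinite := by
  have hone : ∀ᵐ ω ∂(bondMeasure G 1), ∃ v : V, (cluster G ω v).Infinite := by
    filter_upwards [ae_forall_open] with ω hω
    obtain ⟨v⟩ := hG.nonempty
    refine ⟨v, ?_⟩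
    have : cluster G ω v = Set.univ := by
      ext x
      simp only [cluster, openGraph_eq_of_forall_open hω, Set.mem_univ, iff_true]
      exact hG.preconnected v x
    rw [this]
    exact Set.infinite_univ
  -- Retention probability 1 belongs to the set defining the critical probability, so some q < p in
  -- this set exists.
  have hne : {x : ℝ | ∃ q : I, (q : ℝ) = x ∧
      ∀ᵐ ω ∂(bondMeasure G q), ∃ v : V, (cluster G ω v).Infinite}.Nonempty :=
    Exists.intro 1 ⟨1, rfl, hone⟩
  obtain ⟨_, ⟨q, rfl, hq⟩, hqp⟩ := exists_lt_of_csInf_lt hne hp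
  have hset : ∀ ω : Configuration G, (∃ v : V, (cluster G ω v).Infinite) ↔
      ω ∈ connectedToInfinity G Set.univ := fun ω ↦ by simp [connectedToInfinity]
  simp only [hset] at hq ⊢
  have m := measurableSet_connectedToInfinity (G := G) Set.univ
  have h1 := bondMeasure_real_mono m (connectedToInfinity_mono _) (show q ≤ p from hqp.le)
  have h2 : (bondMeasure G q).real (connectedToInfinity G Set.univ) = 1 := by
    rw [measureReal_def, (prob_compl_eq_zero_iff m).1 hq, ENNReal.toReal_one]
  rw [h2] at h1
  have h3 : (bondMeasure G p).real (connectedToInfinity G Set.univ)ᶜ = 0 := by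
    rw [probReal_compl_eq_one_sub m]
    linarith [measureReal_le_one (μ := bondMeasure G p)
      (s := connectedToInfinity G Set.univ)]
  exact (measureReal_eq_zero_iff).1 h3

/-! ### From the volume tail to the dimension of clusters -/

section

variable [G.LocallyFinite]

theorem deg_openGraph_le (ω : Configuration G) (v : V) : deg (openGraph G ω) v ≤ G.degree v := by
  rw [deg, ← SimpleGraph.card_neighborFinset_eq_degree, ← Set.ncard_coe_finset,
    SimpleGraph.coe_neighborFinset]
  exact Set.ncard_le_ncard (fun x hx ↦ openGraph_le ω hx) (Set.toFinite _)

variable [Countable V]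

/-- For p < 1 the exceptional probability is below every ε. For p = 1 the argument by closing edges
is unavailable, and (ii) is used instead: each term of the mean is at most 1, so the mean is at most
the boundary size. -/
theorem ae_exists_anchoredAt (hG : IsBoundedDegree G) {p₀ : ℝ} (h0 : 0 ≤ p₀) {d : EReal}
    (h : VolumeTailBound G p₀ d) {p : I} (hp : p₀ < p) {d' : ℝ} (hd' : 1 < d')
    (hd'd : (d' : EReal) < d) (v : V) :
    ∀ᵐ ω ∂(bondMeasure G p), (cluster G ω v).Infinite →
      ∃ c > 0, AnchoredAt (openGraph G ω) ((d' - 1) / d') c v := by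
  rcases p.2.2.lt_or_eq with hp1 | hp1
  · have hzero : (bondMeasure G p).real {ω | (cluster G ω v).Infinite ∧
        ∀ c > 0, ¬ AnchoredAt (openGraph G ω) ((d' - 1) / d') c v} = 0 := by
      refine le_antisymm (le_of_forall_pos_le_add fun ε hε ↦ ?_) measureReal_nonneg
      obtain ⟨c, hc, hbad⟩ := h.exists_anchoredAt hG hp hp1 hd' hd'd hε
      rw [zero_add]
      have hsub : {ω | (cluster G ω v).Infinite ∧
          ∀ c > 0, ¬ AnchoredAt (openGraph G ω) ((d' - 1) / d') c v} ⊆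
          {ω | (cluster G ω v).Infinite} \
            {ω | AnchoredAt (openGraph G ω) ((d' - 1) / d') c v} :=
        fun ω hω ↦ ⟨hω.1, hω.2 c hc⟩
      exact (measureReal_mono hsub).trans (hbad v)
    rw [measureReal_eq_zero_iff] at hzero
    rw [ae_iff]
    simpa using hzero
  · have hp1' : p = 1 := Subtype.ext hp1
    subst hp1'
    have hbd := boundaryBound_iff.1 (h.boundaryBound hG h0)
    obtain ⟨c, hc, hS⟩ := hbd 1 hp d' hd' hd'd
    filter_upwards [ae_forall_open] with ω hω hinf
    refine ⟨c, hc, hinf, fun W hv _ ↦ ?_⟩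
    rw [ncard_edgeBoundary]
    refine (hS W ⟨v, hv⟩).trans ?_
    have : openBoundary G ω W = boundaryDarts G W := by
      ext d; simp [mem_openBoundary, mem_boundaryDarts, hω]
    rw [this]
    calc meanEscapes G 1 W ≤ ∑ d ∈ boundaryDarts G W, 1 :=
          Finset.sum_le_sum fun _ _ ↦ measureReal_le_one
      _ = _ := by simp

/-- Restricting to rational dimensions leaves countably many null sets, and density of the rationals
recovers the supremum. -/
theorem VolumeTailBound.clusterDimensionBound (hG : IsBoundedDegree G) {p₀ : ℝ} (h0 : 0 ≤ p₀)
    {d : EReal} (hd : 1 < d) (h : VolumeTailBound G p₀ d) : ClusterDimensionBound G p₀ d := by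
  intro p hp
  have hae : ∀ᵐ ω ∂(bondMeasure G p), ∀ v : V, ∀ r : ℚ, 1 < (r : ℝ) → ((r : ℝ) : EReal) < d →
      (cluster G ω v).Infinite →
        ∃ c > 0, AnchoredAt (openGraph G ω) (((r : ℝ) - 1) / r) c v := by
    rw [ae_all_iff]
    intro v
    rw [ae_all_iff]
    intro r
    by_cases hr : 1 < (r : ℝ) ∧ ((r : ℝ) : EReal) < d
    · filter_upwards [ae_exists_anchoredAt hG h0 h hp hr.1 hr.2 v] with ω hω _ _ hinf
      exact hω hinf
    · exact Filter.Eventually.of_forall fun ω h1 h2 ↦ absurd ⟨h1, h2⟩ hr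
  obtain ⟨D, hD⟩ := hG
  filter_upwards [hae] with ω hω C hC
  obtain ⟨v, hv⟩ := hC.nonempty
  have hinf : (cluster G ω v).Infinite := hC.mono fun x hx ↦ C.reachable_of_mem_supp hv hx
  refine le_of_forall_lt_imp_le_of_dense fun y hy ↦ ?_
  obtain ⟨r, hr1, hr2⟩ := EReal.lt_iff_exists_rat_btwn.1 (max_lt hy hd)
  have hr1' : 1 < (r : ℝ) := by exact_mod_cast (le_max_right y 1).trans_lt hr1
  obtain ⟨c, hc, hgood⟩ := hω v r hr1' hr2 hinf
  refine ((le_max_left y 1).trans hr1.le).trans (le_sSup ⟨r, hr1', ?_, rfl⟩)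
  exact hgood.anchoredIsoperimetricInequality C (fun x ↦ (deg_openGraph_le ω x).trans (hD x))
    hr1' hc hv

/-! ### Transitive graphs -/

/-- One inequality is enough for the application, since `φ` may carry any vertex to the
distinguished one. -/
theorem real_anchoredAt_le (φ : G ≃g G) (p : I) (α c : ℝ) (v : V) :
    (bondMeasure G p).real {ω | AnchoredAt (openGraph G ω) α c (φ v)} ≤
      (bondMeasure G p).real {ω | AnchoredAt (openGraph G ω) α c v} := by
  have hm : Measurable fun (ω : Configuration G) e ↦ ω (φ.mapEdgeSet e) := by fun_prop
  conv_rhs => rw [← map_comp_automorphism φ p,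
    map_measureReal_apply hm (measurableSet_anchoredAt α c v)]
  exact measureReal_mono fun ω hω ↦ AnchoredAt.of_iso (openGraphIso φ ω) hω

theorem ClusterDimensionBound.boundaryBound [Infinite V] (hG : G.Connected)
    (htrans : IsTransitive G) {p₀ : ℝ} (hpc : criticalProbability G ≤ p₀) {d : EReal}
    (h : ClusterDimensionBound G p₀ d) : BoundaryBound G p₀ d := by
  rw [boundaryBound_iff]
  intro p hp d' hd' hd'd
  -- Constants of the form 1/(n+1) make the choice of anchor and constant countable, so some fixed
  -- pair occurs with positive probability.
  have hex : ∀ᵐ ω ∂(bondMeasure G p), ∃ x : V × ℕ,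
      AnchoredAt (openGraph G ω) ((d' - 1) / d') (1 / ((x.2 : ℝ) + 1)) x.1 := by
    filter_upwards [h p hp, ae_exists_infinite hG (hpc.trans_lt hp)] with ω hω ⟨v, hv⟩
    let C := (openGraph G ω).connectedComponentMk v
    have hC : C.supp.Infinite := hv.mono fun x hx ↦
      SimpleGraph.ConnectedComponent.eq.2 (SimpleGraph.Reachable.symm hx)
    obtain ⟨_, ⟨r, hr1, hr, rfl⟩, hlt⟩ := lt_sSup_iff.1 (hd'd.trans_le (hω C hC))
    have hle : d' ≤ r := by exact_mod_cast hlt.le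
    obtain ⟨u, c, hc, hu⟩ := hr.exists_anchoredAt C
      (fun x ↦ (G.neighborSet x).toFinite.subset fun y hy ↦ openGraph_le ω hy) hC hd' hle
    obtain ⟨n, hn⟩ := exists_nat_one_div_lt hc
    exact ⟨(u, n), hu.mono hn.le⟩
  have hpos : ∃ x : V × ℕ, 0 < (bondMeasure G p).real
      {ω | AnchoredAt (openGraph G ω) ((d' - 1) / d') (1 / ((x.2 : ℝ) + 1)) x.1} := by
    by_contra! hneg
    have h1 : ∀ᵐ ω ∂(bondMeasure G p), ∀ x : V × ℕ,
        ¬ AnchoredAt (openGraph G ω) ((d' - 1) / d') (1 / ((x.2 : ℝ) + 1)) x.1 := by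
      rw [ae_all_iff]
      intro x
      rw [ae_iff]
      simp only [not_not]
      exact (measureReal_eq_zero_iff).1 (le_antisymm (hneg x) measureReal_nonneg)
    obtain ⟨ω, ⟨x, hx⟩, hω⟩ := (hex.and h1).exists
    exact hω x hx
  obtain ⟨⟨u, n⟩, hθ⟩ := hpos
  have hα0 : 0 ≤ (d' - 1) / d' := div_nonneg (by linarith) (by linarith)
  have hα1 : (d' - 1) / d' ≤ 1 := by rw [div_le_one (by linarith)]; linarith
  have hc : (0 : ℝ) < 1 / ((n : ℝ) + 1) := by positivity
  refine ⟨_ * (1 / ((n : ℝ) + 1)), mul_pos hθ hc, fun S hS ↦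
    le_meanEscapes_of_anchoredAt hα0 hα1 hc.le (fun w ↦ ?_) hS⟩
  obtain ⟨φ, rfl⟩ := htrans w u
  exact real_anchoredAt_le φ p _ _ w

end

end Percolation

theorem theorem1p1 {V : Type*} [Infinite V] (G : SimpleGraph V) [G.LocallyFinite]
    (hconn : G.Connected) (p₀ : ℝ) (hpc : Percolation.criticalProbability G ≤ p₀) (hp₀ : p₀ < 1)
    (d : EReal) (hd : 1 < d) :
    (Percolation.IsTransitive G →
      List.TFAE [Percolation.DisconnectionBound G p₀ d, Percolation.BoundaryBound G p₀ d,
        Percolation.VolumeTailBound G p₀ d, Percolation.ClusterDimensionBound G p₀ d]) ∧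
    (Percolation.IsBoundedDegree G →
      (Percolation.DisconnectionBound G p₀ d ↔ Percolation.BoundaryBound G p₀ d) ∧
      (Percolation.BoundaryBound G p₀ d → Percolation.VolumeTailBound G p₀ d) ∧
      (Percolation.VolumeTailBound G p₀ d → Percolation.ClusterDimensionBound G p₀ d)) := by
  have := Percolation.countable_of_connected hconn
  have h0 : 0 ≤ p₀ := (Percolation.criticalProbability_nonneg G).trans hpc
  refine ⟨fun htrans ↦ ?_, fun hG ↦ ⟨⟨fun h ↦ h.boundaryBound h0, fun h ↦ h.disconnectionBound h0⟩,
    fun h ↦ (h.disconnectionBound h0).volumeTailBound h0,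
    fun h ↦ h.clusterDimensionBound hG h0 hd⟩⟩
  have hG := htrans.isBoundedDegree
  tfae_have 1 → 2 := fun h ↦ h.boundaryBound h0
  tfae_have 2 → 1 := fun h ↦ h.disconnectionBound h0
  tfae_have 1 → 3 := fun h ↦ h.volumeTailBound h0
  tfae_have 3 → 4 := fun h ↦ h.clusterDimensionBound hG h0 hd
  tfae_have 4 → 2 := fun h ↦ h.boundaryBound hconn htrans hpc
  tfae_finish
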